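/- **Setting.** Let $f\ge 1$ and $N=3f+1$ nodes $\mathcal P_1,\dots,\mathcal P_N$, at most $f$ of them dishonest. An execution is a sequence of atomic steps. In each step the adversary picks one node and a set of pending messages to it, which are thereby delivered; the node reads them, computes, and sends finitely many messages. Links are authenticated, every message is eventually delivered, and every node acts at least once. Dishonest nodes send arbitrary messages; an honest node performs the actions of the protocol below until none is possible. *Asynchronous rounds*: round $0$ ends with the first step $l_0$ after which every node has acted; round $i\ge1$ consists of the steps after $l_{i-1}$ up to and including $l_i$, the step (after $l_{i-1}$) in which the last message sent during round $i-1$ is delivered. **Units.** A unit has a creator, a list of parents (units, referred to by collision-free hashes) and data. Its DAG-round is $0$ if it has no parents, and otherwise one more than the maximal DAG-round of a parent; $V\le U$ means that $V$ is reached from $U$ along parent pointers. A set of units is a *ch-DAG* if it contains the parents of its members, the units of each honest node in it form a chain for $\le$, each of its units of DAG-round $r>0$ has at least $2f+1$ parents of DAG-round $r-1$, and the parents of each of its units have pairwise distinct creators. **DAG-Grow.** An honest $\mathcal P_i$ keeps a local copy $\mathcal D_i$, initially empty. For $r=0,1,2,\dots$ it waits (if $r>0$) until $\mathcal D_i$ has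 at least $2f+1$ units of DAG-round $r-1$; then it creates a unit $U$ whose parents are, for each node having units of DAG-round $<r$ in $\mathcal D_i$, the one of maximal DAG-round among these, adds $U$ to $\mathcal D_i$ and starts ch-RBC for $U$. In parallel, each unit locally output by ch-RBC is added to $\mathcal D_i$ (as soon as its parents are there). **ch-RBC**, instance $(s,r)$ in which $\mathcal P_s$ broadcasts its unit $U$ of DAG-round $r$. The sender encodes $U$ into $N$ shares by an $(f+1,N)$-erasure code, computes the root $h$ of their Merkle tree (over a collision-free hash function), and sends $\mathsf{propose}(h,b_j,s_j)$ with the $j$-th share $s_j$ and its Merkle branch $b_j$ to $\mathcal P_j$ for all $j$. A node takes into account only the first proposal of an instance; if the share passes the size check (the number of transactions of the unit, read off the size of its share, is at most $C_B$ times the node's own batch size for round $r$), then once its local copy has reached DAG-round $r-1$ it multicasts $\mathsf{prevote}(h,b_j,s_j)$. After $2f+1$ prevotes for $h$ with valid Merkle branches, it reconstructs $U$; if $U$ is valid (creator $\mathcal P_s$, DAG-round $r$, at least $2f+1$ parents of DAG-round $r-1$ if $r>0$, parents with pairwise distinct creators, one of them $\mathcal P_s$ if $r>0$, valid data), it waits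 until all parents of $U$ are locally output, and if the shares of $U$ have Merkle root $h$ it multicasts $\mathsf{commit}(h)$. It also multicasts $\mathsf{commit}(h)$ after $f+1$ commits for $h$, in either case at most one commit per instance. After $2f+1$ commits for $h$ it locally outputs the unit decoded from the shares. Honest nodes include valid data in their units, and the batch sizes of any two honest nodes for the same DAG-round differ by a factor of at most $C_B$ (uniform buffer distribution). **Theorem 3.2.** In every execution of DAG-Grow with ch-RBC, the local copy of every honest node is a ch-DAG at all times, and the protocol is 1. *reliable*: every unit in the local copy $\mathcal D_i$ of an honest node is eventually in the local copy $\mathcal D_j$ of every honest node; 2. *ever-expanding*: for every honest node the maximal DAG-round of a unit in $\mathcal D_i$ grows without bound; 3. *fork-free*: if honest nodes hold units $U_1\in\mathcal D_{i_1}$ and $U_2\in\mathcal D_{i_2}$ (at any times) with the same creator and the same DAG-round, then $U_1=U_2$. Moreover, the asynchronous rounds are well defined, and during asynchronous round $r$ each honest node holds a local copy of DAG-round $\Omega(r)$: for every $r\ge1$, at every step of asynchronous round $r$ the local copy of each honest node contains a unit of DAG-round at least $\lfloor r/5\rfloor$ that the node created itself. -/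

import Mathlib

universe u v w

/-! ### Units and communication history DAGs -/

/-- A unit: its creator, its list of parents and its data.  Under a collision-free hash function a
list of parent hashes determines the parent units, so a unit carries the parents themselves. -/
inductive DagUnit (N : ℕ) (Data : Type u) : Type u where
  | mk (creator : Fin N) (parents : List (DagUnit N Data)) (data : Data) : DagUnit N Data

namespace DagUnit

variable {N : ℕ} {Data : Type u}

/-- The node that created the unit. -/
def creator : DagUnit N Data → Fin N
  | mk c _ _ => c

/-- The parents of the unit. -/
def parents : DagUnit N Data → List (DagUnit N Data)
  | mk _ ps _ => ps

/-- The additional data included in the unit. -/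
def data : DagUnit N Data → Data
  | mk _ _ d => d

/-- The DAG-round of a unit: `0` without parents, otherwise one more than the maximal DAG-round of
a parent. -/
def round : DagUnit N Data → ℕ
  | mk _ ps _ => (ps.attach.map fun p => round p.1 + 1).foldr max 0
termination_by U => sizeOf U
decreasing_by
  have := List.sizeOf_lt_of_mem p.2
  simp only [mk.sizeOf_spec]
  omega

theorem round_mk (c : Fin N) (ps : List (DagUnit N Data)) (d : Data) :
    (mk c ps d).round = (ps.map fun p => p.round + 1).foldr max 0 := by
  rw [round, List.attach_map_val (f := fun p : DagUnit N Data => p.round + 1)]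

/-- `Below V U` is the causal order `V ≤ U`: `V` is reached from `U` by following parent pointers
(zero or more times). -/
def Below (V U : DagUnit N Data) : Prop :=
  Relation.ReflTransGen (fun A B : DagUnit N Data => A ∈ B.parents) V U

/-- A unit of positive DAG-round `r` has at least `2f+1` parents of DAG-round `r-1`. -/
def Disseminated (f : ℕ) (U : DagUnit N Data) : Prop :=
  0 < U.round →
    ∃ Q : Finset (DagUnit N Data), 2 * f + 1 ≤ Q.card ∧
      ∀ V ∈ Q, V ∈ U.parents ∧ V.round + 1 = U.round

/-- The parents of the unit are created by pairwise distinct nodes. -/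
def Diverse (U : DagUnit N Data) : Prop :=
  (U.parents.map creator).Nodup

end DagUnit

/-- A set of units is a ch-DAG (`byz` is the set of dishonest nodes): it contains the parents of
its members, the units of an honest node form a chain, and Dissemination and Diversity hold. -/
structure IsChDag {N : ℕ} {Data : Type u} (f : ℕ) (byz : Finset (Fin N))
    (D : Set (DagUnit N Data)) : Prop where
  closed : ∀ U ∈ D, ∀ V ∈ U.parents, V ∈ D
  chains : ∀ i, i ∉ byz → ∀ U ∈ D, ∀ V ∈ D, U.creator = i → V.creator = i →
    U.Below V ∨ V.Below U
  dissemination : ∀ U ∈ D, U.Disseminated f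
  diversity : ∀ U ∈ D, U.Diverse

/-! ### Properties of a protocol that grows a common ch-DAG

`D i t` is the local copy held by node `i` at time `t`. -/

/-- Every unit in the local copy of an honest node is eventually in the local copy of every honest
node. -/
def Reliable {N : ℕ} {Data : Type u} (byz : Finset (Fin N))
    (D : Fin N → ℕ → Set (DagUnit N Data)) : Prop :=
  ∀ i, i ∉ byz → ∀ t, ∀ U ∈ D i t, ∀ j, j ∉ byz → ∃ t', U ∈ D j t'

/-- The maximal DAG-round of the local copy of every honest node is unbounded over time. -/
def EverExpanding {N : ℕ} {Data : Type u} (byz : Finset (Fin N))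
    (D : Fin N → ℕ → Set (DagUnit N Data)) : Prop :=
  ∀ i, i ∉ byz → ∀ n : ℕ, ∃ t, ∃ U ∈ D i t, n ≤ U.round

/-- Two units with the same creator and DAG-round that are held by honest nodes are equal. -/
def ForkFree {N : ℕ} {Data : Type u} (byz : Finset (Fin N))
    (D : Fin N → ℕ → Set (DagUnit N Data)) : Prop :=
  ∀ i₁, i₁ ∉ byz → ∀ i₂, i₂ ∉ byz → ∀ t₁ t₂, ∀ U₁ ∈ D i₁ t₁, ∀ U₂ ∈ D i₂ t₂,
    U₁.creator = U₂.creator → U₁.round = U₂.round → U₁ = U₂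

/-! ### Merkle trees -/

namespace Merkle

variable {Share : Type v} {Digest : Type w}

/-- The label of the `k`-th node at height `d` of the Merkle tree with leaves `s 0, s 1, …`; its
children are the nodes `2k` and `2k+1` at height `d-1`. -/
def label (H : Option Share ⊕ Digest × Digest → Digest) (s : ℕ → Option Share) : ℕ → ℕ → Digest
  | 0, k => H (Sum.inl (s k))
  | d + 1, k => H (Sum.inr (label H s d (2 * k), label H s d (2 * k + 1)))

/-- The vector of shares as a sequence of leaves, padded by `none`. -/
def leaves {N : ℕ} (s : Fin N → Share) (k : ℕ) : Option Share :=
  if h : k < N then some (s ⟨k, h⟩) else none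

/-- The Merkle root of `N` shares; the tree has height `⌈log₂ N⌉`. -/
def root {N : ℕ} (H : Option Share ⊕ Digest × Digest → Digest) (s : Fin N → Share) : Digest :=
  label H (leaves s) (Nat.clog 2 N) 0

/-- The Merkle branch of the `j`-th share: the labels of the siblings of the nodes on the path from
the leaf to the root. -/
def branch {N : ℕ} (H : Option Share ⊕ Digest × Digest → Digest) (s : Fin N → Share) (j : Fin N) :
    List Digest :=
  (List.range (Nat.clog 2 N)).map fun d =>
    let k := (j : ℕ) / 2 ^ d
    label H (leaves s) d (if k % 2 = 0 then k + 1 else k - 1)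

/-- The root label computed from the label `x` of the `k`-th node of some height and the labels of
the siblings above it. -/
def climb (H : Option Share ⊕ Digest × Digest → Digest) : Digest → ℕ → List Digest → Digest
  | x, _, [] => x
  | x, k, y :: ys =>
      climb H (H (Sum.inr (if k % 2 = 0 then (x, y) else (y, x)))) (k / 2) ys

/-- The check that `b` is a Merkle branch leading from the share `σ` at position `j` to root `h`. -/
def Verifies {N : ℕ} (H : Option Share ⊕ Digest × Digest → Digest) (h : Digest) (j : Fin N)
    (b : List Digest) (σ : Share) : Prop :=
  b.length = Nat.clog 2 N ∧ climb H (H (Sum.inl (some σ))) j b = h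

end Merkle

/-! ### Parameters of the protocol -/

/-- The public parameters for `N = 3f+1` nodes. -/
structure Params (f : ℕ) (Data : Type u) (Share : Type v) (Digest : Type w) where
  /-- The number of transactions in the data of a unit. -/
  numTx : Data → ℕ
  /-- The data field contains all required components. -/
  DataValid : Data → Prop
  /-- The constant of the size check. -/
  CB : ℝ
  /-- An `(f+1, N)`-erasure coding of units into shares. -/
  encode : DagUnit (3 * f + 1) Data → Fin (3 * f + 1) → Share
  /-- Any `f+1` shares determine the encoded unit. -/
  encode_inj : ∀ (U V : DagUnit (3 * f + 1) Data) (Q : Finset (Fin (3 * f + 1))),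
    f + 1 ≤ Q.card → (∀ j ∈ Q, encode U j = encode V j) → U = V
  /-- The number of transactions of a unit, inferred from the size of one of its shares. -/
  shareTx : Share → ℕ
  shareTx_encode : ∀ U j, shareTx (encode U j) = numTx U.data
  /-- The hash function of the Merkle trees. -/
  hash : Option Share ⊕ Digest × Digest → Digest
  /-- The hash function is collision-free. -/
  hash_inj : Function.Injective hash

/-- The messages of ch-RBC.  The instance in which node `s` broadcasts its unit of DAG-round `r` is
identified by `(s, r)`; a proposal belongs to the instance of the node it is received from. -/
inductive RbcMsg (N : ℕ) (Share : Type v) (Digest : Type w) : Type (max v w) where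
  | propose (r : ℕ) (h : Digest) (b : List Digest) (σ : Share)
  | prevote (s : Fin N) (r : ℕ) (h : Digest) (b : List Digest) (σ : Share)
  | commit (s : Fin N) (r : ℕ) (h : Digest)

/-- The local state of an honest node. -/
structure NodeState (N : ℕ) (Data : Type u) (Share : Type v) (Digest : Type w) where
  /-- The messages received so far, with their senders. -/
  rcvd : Set (Fin N × RbcMsg N Share Digest)
  /-- The first proposal received in each instance; later ones are ignored. -/
  proposal : Fin N → ℕ → Option (Digest × List Digest × Share)
  /-- The instances in which a prevote has been sent. -/
  prevoted : Set (Fin N × ℕ)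
  /-- The instances in which a commit has been sent. -/
  committed : Set (Fin N × ℕ)
  /-- The unit locally output in each instance. -/
  output : Fin N → ℕ → Option (DagUnit N Data)
  /-- The local copy of the ch-DAG. -/
  dag : Set (DagUnit N Data)
  /-- The DAG-round of the next unit to be created. -/
  next : ℕ
  /-- The messages sent in the current atomic step, with their recipients. -/
  outbox : List (Fin N × RbcMsg N Share Digest)

namespace NodeState

variable {N : ℕ} {Data : Type u} {Share : Type v} {Digest : Type w}

/-- The state before the first action of the node. -/
def initial : NodeState N Data Share Digest where
  rcvd := ∅
  proposal := fun _ _ => none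
  prevoted := ∅
  committed := ∅
  output := fun _ _ => none
  dag := ∅
  next := 0
  outbox := []

/-- Reading the message `m` received from the node `src`. -/
def receive (st : NodeState N Data Share Digest) (src : Fin N) (m : RbcMsg N Share Digest) :
    NodeState N Data Share Digest :=
  { st with
    rcvd := insert (src, m) st.rcvd
    proposal := match m with
      | .propose r h b σ => fun s' r' =>
          (st.proposal s' r').or (if s' = src ∧ r' = r then some (h, b, σ) else none)
      | _ => st.proposal }

/-- Sending the message `m` to every node, the sender included. -/
def multicast (m : RbcMsg N Share Digest) : List (Fin N × RbcMsg N Share Digest) :=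
  (List.finRange N).map fun j => (j, m)

/-- The valid shares for the root `h` received in prevotes of the instance `(s, r)`: the share of
node `j` has to come from `j` with a Merkle branch from position `j` to `h`. -/
def validShares (H : Option Share ⊕ Digest × Digest → Digest) (st : NodeState N Data Share Digest)
    (s : Fin N) (r : ℕ) (h : Digest) : Set (Fin N × Share) :=
  {x | ∃ b, (x.1, RbcMsg.prevote s r h b x.2) ∈ st.rcvd ∧ Merkle.Verifies H h x.1 b x.2}

/-- Valid prevotes for `h` were received from at least `k` nodes. -/
def PrevotesFrom (H : Option Share ⊕ Digest × Digest → Digest) (st : NodeState N Data Share Digest)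
    (k : ℕ) (s : Fin N) (r : ℕ) (h : Digest) : Prop :=
  ∃ Q : Finset (Fin N), k ≤ Q.card ∧ ∀ j ∈ Q, ∃ σ, (j, σ) ∈ st.validShares H s r h

/-- Commits for `h` were received from at least `k` nodes. -/
def CommitsFrom (st : NodeState N Data Share Digest) (k : ℕ) (s : Fin N) (r : ℕ) (h : Digest) :
    Prop :=
  ∃ Q : Finset (Fin N), k ≤ Q.card ∧ ∀ j ∈ Q, (j, RbcMsg.commit s r h) ∈ st.rcvd

/-- The unit `U` was locally output in some instance. -/
def HasOutput (st : NodeState N Data Share Digest) (U : DagUnit N Data) : Prop :=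
  ∃ s r, st.output s r = some U

/-- `P` consists of one unit of DAG-round `< r` in the local ch-DAG for every node that created
such a unit there, of maximal DAG-round among these. -/
def IsParentChoice (st : NodeState N Data Share Digest) (r : ℕ) (P : List (DagUnit N Data)) :
    Prop :=
  (P.map DagUnit.creator).Nodup ∧
  (∀ V ∈ P, V ∈ st.dag ∧ V.round < r ∧
    ∀ W ∈ st.dag, W.creator = V.creator → W.round < r → W.round ≤ V.round) ∧
  (∀ W ∈ st.dag, W.round < r → ∃ V ∈ P, V.creator = W.creator)

end NodeState

section Protocol

variable {f : ℕ} {Data : Type u} {Share : Type v} {Digest : Type w}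

/-- The predicate `Valid(U)` in the instance `(s, r)`: the unit is a unit of `s` of DAG-round `r`,
it has enough parents by distinct creators, one of them by its own creator, and its data is
valid. -/
def ValidUnit (S : Params f Data Share Digest) (s : Fin (3 * f + 1)) (r : ℕ)
    (U : DagUnit (3 * f + 1) Data) : Prop :=
  U.creator = s ∧ U.round = r ∧ U.Disseminated f ∧ U.Diverse ∧
  (0 < r → ∃ V ∈ U.parents, V.creator = s) ∧ S.DataValid U.data

/-- `U` is decoded from the set `A` of shares: there are shares of at least `f+1` nodes, and all
of them are shares of `U`. -/
def Decodes (S : Params f Data Share Digest) (A : Set (Fin (3 * f + 1) × Share))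
    (U : DagUnit (3 * f + 1) Data) : Prop :=
  (∃ Q : Finset (Fin (3 * f + 1)), f + 1 ≤ Q.card ∧ ∀ j ∈ Q, ∃ σ, (j, σ) ∈ A) ∧
  ∀ x ∈ A, S.encode U x.1 = x.2

/-- The elementary actions of DAG-Grow and ch-RBC at the honest node `i`, where `inp r` is the data
that `i` includes in its unit of DAG-round `r`. -/
inductive Act (S : Params f Data Share Digest) (i : Fin (3 * f + 1)) (inp : ℕ → Data) :
    NodeState (3 * f + 1) Data Share Digest → NodeState (3 * f + 1) Data Share Digest → Prop where
  /-- Create the next unit as soon as `2f+1` units of the previous DAG-round are in the local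
  ch-DAG, add it to the local ch-DAG and start ch-RBC for it. -/
  | create (st : NodeState (3 * f + 1) Data Share Digest) (P : List (DagUnit (3 * f + 1) Data))
      (U : DagUnit (3 * f + 1) Data)
      (hwait : 0 < st.next → ∃ Q : Finset (DagUnit (3 * f + 1) Data), 2 * f + 1 ≤ Q.card ∧
        ∀ V ∈ Q, V ∈ st.dag ∧ V.round + 1 = st.next)
      (hP : st.IsParentChoice st.next P)
      (hU : U = DagUnit.mk i P (inp st.next)) :
      Act S i inp st
        { st with
          dag := insert U st.dag
          next := st.next + 1
          outbox := st.outbox ++ (List.finRange (3 * f + 1)).map fun j =>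
            (j, RbcMsg.propose st.next (Merkle.root S.hash (S.encode U))
              (Merkle.branch S.hash (S.encode U) j) (S.encode U j)) }
  /-- Prevote for the first proposal of an instance of DAG-round `r`, if it passes the size check,
  once the local ch-DAG has reached DAG-round `r-1`. -/
  | prevote (st : NodeState (3 * f + 1) Data Share Digest) (s : Fin (3 * f + 1)) (r : ℕ)
      (h : Digest) (b : List Digest) (σ : Share)
      (hprop : st.proposal s r = some (h, b, σ))
      (hsize : (S.shareTx σ : ℝ) ≤ S.CB * (S.numTx (inp r) : ℝ))
      (hwait : 0 < r → ∃ V ∈ st.dag, r ≤ V.round + 1)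
      (hnew : (s, r) ∉ st.prevoted) :
      Act S i inp st
        { st with
          prevoted := insert (s, r) st.prevoted
          outbox := st.outbox ++ NodeState.multicast (RbcMsg.prevote s r h b σ) }
  /-- Commit after `2f+1` valid prevotes, if the reconstructed unit is valid and its shares have
  the announced Merkle root, once all its parents are locally output. -/
  | commit (st : NodeState (3 * f + 1) Data Share Digest) (s : Fin (3 * f + 1)) (r : ℕ)
      (h : Digest) (U : DagUnit (3 * f + 1) Data)
      (hvotes : st.PrevotesFrom S.hash (2 * f + 1) s r h)
      (hdec : Decodes S (st.validShares S.hash s r h) U)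
      (hvalid : ValidUnit S s r U)
      (hwait : ∀ V ∈ U.parents, st.HasOutput V)
      (hroot : Merkle.root S.hash (S.encode U) = h)
      (hnew : (s, r) ∉ st.committed) :
      Act S i inp st
        { st with
          committed := insert (s, r) st.committed
          outbox := st.outbox ++ NodeState.multicast (RbcMsg.commit s r h) }
  /-- Commit after `f+1` commits. -/
  | amplify (st : NodeState (3 * f + 1) Data Share Digest) (s : Fin (3 * f + 1)) (r : ℕ)
      (h : Digest)
      (hcommits : st.CommitsFrom (f + 1) s r h)
      (hnew : (s, r) ∉ st.committed) :
      Act S i inp st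
        { st with
          committed := insert (s, r) st.committed
          outbox := st.outbox ++ NodeState.multicast (RbcMsg.commit s r h) }
  /-- Locally output the decoded unit after `2f+1` commits. -/
  | output (st : NodeState (3 * f + 1) Data Share Digest) (s : Fin (3 * f + 1)) (r : ℕ)
      (h : Digest) (U : DagUnit (3 * f + 1) Data)
      (hcommits : st.CommitsFrom (2 * f + 1) s r h)
      (hdec : Decodes S (st.validShares S.hash s r h) U)
      (hnew : st.output s r = none) :
      Act S i inp st
        { st with
          output := fun s' r' => if s' = s ∧ r' = r then some U else st.output s' r' }
  /-- Add a locally output unit to the local ch-DAG, as soon as its parents are there. -/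
  | attach (st : NodeState (3 * f + 1) Data Share Digest) (U : DagUnit (3 * f + 1) Data)
      (hout : st.HasOutput U)
      (hparents : ∀ V ∈ U.parents, V ∈ st.dag)
      (hnew : U ∉ st.dag) :
      Act S i inp st { st with dag := insert U st.dag }

/-- An atomic step of the honest node `i`: it reads the messages `ms` (with their senders), and
acts until no further action is possible.  The messages sent are in the outbox of `st'`. -/
def HonestStep (S : Params f Data Share Digest) (i : Fin (3 * f + 1)) (inp : ℕ → Data)
    (ms : List (Fin (3 * f + 1) × RbcMsg (3 * f + 1) Share Digest))
    (st st' : NodeState (3 * f + 1) Data Share Digest) : Prop :=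
  Relation.ReflTransGen (Act S i inp)
    (ms.foldl (fun s m => s.receive m.1 m.2) { st with outbox := [] }) st' ∧
  ∀ st'', ¬ Act S i inp st' st''

/-- A message in the network: the atomic step in which it was sent, its recipient and its
content. -/
structure Packet (N : ℕ) (Share : Type v) (Digest : Type w) where
  sentAt : ℕ
  dst : Fin N
  msg : RbcMsg N Share Digest

/-- An execution of DAG-Grow with ch-RBC in the asynchronous network model, where the nodes in
`byz` are dishonest.  The adversary chooses the acting nodes, the delivered messages and everything
that dishonest nodes send; links are authenticated. -/
structure Execution (S : Params f Data Share Digest) (byz : Finset (Fin (3 * f + 1))) where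
  /-- The data that a node includes in its unit of a given DAG-round. -/
  input : Fin (3 * f + 1) → ℕ → Data
  /-- The node that acts in the atomic step `t`. -/
  actor : ℕ → Fin (3 * f + 1)
  /-- The messages sent by the acting node in the atomic step `t`, with their recipients. -/
  sent : ℕ → List (Fin (3 * f + 1) × RbcMsg (3 * f + 1) Share Digest)
  /-- The messages delivered to the acting node in the atomic step `t`. -/
  delivered : ℕ → List (Packet (3 * f + 1) Share Digest)
  /-- The local state of an honest node before the atomic step `t`. -/
  state : ℕ → Fin (3 * f + 1) → NodeState (3 * f + 1) Data Share Digest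
  /-- Only pending messages to the acting node are delivered, each of them once. -/
  delivered_nodup : ∀ t, (delivered t).Nodup
  delivered_pending : ∀ t, ∀ p ∈ delivered t, p.dst = actor t ∧ p.sentAt < t ∧
    (p.dst, p.msg) ∈ sent p.sentAt ∧ ∀ t' < t, p ∉ delivered t'
  /-- Every message is eventually delivered. -/
  eventually_delivered : ∀ t, ∀ m ∈ sent t, ∃ t', Packet.mk t m.1 m.2 ∈ delivered t'
  /-- Every node acts at least once. -/
  all_act : ∀ i, ∃ t, actor t = i
  state_zero : ∀ i, i ∉ byz → state 0 i = NodeState.initial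
  /-- A node that is not acting does not change its state. -/
  state_idle : ∀ t i, i ∉ byz → i ≠ actor t → state (t + 1) i = state t i
  /-- Honest nodes follow the protocol; the sender of a packet is the node that acted when it was
  sent. -/
  state_act : ∀ t, actor t ∉ byz →
    HonestStep S (actor t) (input (actor t))
      ((delivered t).map fun p => (actor p.sentAt, p.msg))
      (state t (actor t)) (state (t + 1) (actor t))
  sent_honest : ∀ t, actor t ∉ byz → sent t = (state (t + 1) (actor t)).outbox

namespace Execution

variable {S : Params f Data Share Digest} {byz : Finset (Fin (3 * f + 1))}

/-- The local copy of the ch-DAG of node `i` before the atomic step `t`. -/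
def localDag (E : Execution S byz) (i : Fin (3 * f + 1)) (t : ℕ) : Set (DagUnit (3 * f + 1) Data) :=
  (E.state t i).dag

/-- The atomic step `t` has asynchronous round `r`, if round `k` ends with the step `l k`. -/
def InRound (l : ℕ → ℕ) (r t : ℕ) : Prop :=
  t ≤ l r ∧ ∀ k < r, l k < t

/-- `l 0, l 1, …` are the last steps of the asynchronous rounds `0, 1, …`: after `l 0` every node
has acted at least once, and round `r+1` ends when the last message sent during round `r` is
delivered. -/
def IsRoundEnds (E : Execution S byz) (l : ℕ → ℕ) : Prop :=
  IsLeast {t | ∀ i, ∃ t' ≤ t, E.actor t' = i} (l 0) ∧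
  ∀ r, IsLeast {t | l r < t ∧ ∀ τ, InRound l r τ → ∀ m ∈ E.sent τ,
    ∃ t' ≤ t, Packet.mk τ m.1 m.2 ∈ E.delivered t'} (l (r + 1))

/-- The data of honest units is valid. -/
def HonestInputsValid (E : Execution S byz) : Prop :=
  ∀ i, i ∉ byz → ∀ r, S.DataValid (E.input i r)

/-- The batch sizes of two honest nodes for the same DAG-round have ratio at most `CB`. -/
def UniformBuffers (E : Execution S byz) : Prop :=
  ∀ i, i ∉ byz → ∀ j, j ∉ byz → ∀ r,
    (S.numTx (E.input i r) : ℝ) ≤ S.CB * (S.numTx (E.input j r) : ℝ)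

end Execution

end Protocol

/-!
The proof follows the state of each honest node through an execution by the invariant `LocalInv`,
which relates the state to the log of all messages that the node has sent, and then argues about
honest nodes only.

*Safety.* As `f+1` commits include an honest one, every commit of an honest node traces back to an
honest node that commits because of `2f+1` prevotes for a root `h`: the root and the unit with this
root are then `Certified`. Two quorums of prevotes share an honest node, so that an instance has at
most one certified unit (`Execution.Certified.unique`). An output unit is decoded from `f+1` shares
valid for a certified root; Merkle trees over an injective hash function determine their leaves
(`Merkle.Verifies.eq_share`), so the output unit is the certified one. If the sender is honest, then
an honest prevote behind the certificate answers its only proposal, and the certified unit is its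
own (`Execution.Certified.eq_ownUnit`). Fork-freeness follows. It implies that the units awaited
before the creation of a unit have distinct creators, hence become parents, and that each own unit
is a parent of the next one; this gives Dissemination and the chains of a ch-DAG.

*Liveness.* After its first step an honest node is always in a state without possible actions, so
whatever an action would need is either missing or the action has been performed. An output of one
honest node is therefore an output of all of them two asynchronous rounds later, and since the
parents of a certified unit were output by an honest node before, the unit is by then in all honest
local copies (`Execution.IsRoundEnds.mem_dag_of_hasOutput`). Once all honest nodes have created
their units of DAG-round `r`, the proposals, the prevotes and the commits for them take one
asynchronous round each, and within the first two of these the foreign parents become outputs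
everywhere. So these units are in all honest local copies three asynchronous rounds later, and the
units of DAG-round `r+1` can be created (`Execution.IsRoundEnds.progress`): by the end of the
asynchronous round `3r` each honest node has created its unit of DAG-round `r`, which is more than
the claim asks for.
-/

/-! ### Merkle trees determine their leaves -/

namespace Merkle

variable {Share : Type v} {Digest : Type w} {H : Option Share ⊕ Digest × Digest → Digest}

theorem eq_label_of_climb_eq (hH : Function.Injective H) (s : ℕ → Option Share) (b : List Digest) :
    ∀ (x : Digest) (d k : ℕ),
      climb H x k b = label H s (d + b.length) (k / 2 ^ b.length) → x = label H s d k := by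
  induction b with
  | nil => intro x d k h; simpa [climb] using h
  | cons y b ih =>
    intro x d k h
    have h1 := ih (H (Sum.inr (if k % 2 = 0 then (x, y) else (y, x)))) (d + 1) (k / 2) (by
      rw [climb, List.length_cons] at h
      rw [h, Nat.div_div_eq_div_mul, pow_succ', show d + (b.length + 1) = d + 1 + b.length by omega])
    rw [label] at h1
    have h2 := Sum.inr_injective (hH h1)
    split_ifs at h2 with hk
    · rw [(Prod.mk.inj h2).1, show 2 * (k / 2) = k by omega]
    · rw [(Prod.mk.inj h2).2, show 2 * (k / 2) + 1 = k by omega]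

theorem climb_label (s : ℕ → Option Share) (n : ℕ) : ∀ d k : ℕ,
    climb H (label H s d k) k ((List.range n).map fun e =>
      label H s (d + e) (if k / 2 ^ e % 2 = 0 then k / 2 ^ e + 1 else k / 2 ^ e - 1)) =
      label H s (d + n) (k / 2 ^ n) := by
  induction n with
  | zero => intro d k; simp [climb]
  | succ n ih =>
    intro d k
    rw [List.range_succ_eq_map, List.map_cons, climb, List.map_map]
    have h1 : H (Sum.inr (if k % 2 = 0 then
          (label H s d k, label H s (d + 0)
            (if k / 2 ^ 0 % 2 = 0 then k / 2 ^ 0 + 1 else k / 2 ^ 0 - 1))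
        else (label H s (d + 0) (if k / 2 ^ 0 % 2 = 0 then k / 2 ^ 0 + 1 else k / 2 ^ 0 - 1),
          label H s d k))) = label H s (d + 1) (k / 2) := by
      rw [label]
      simp only [pow_zero, Nat.div_one, add_zero]
      split_ifs with hk
      · rw [show 2 * (k / 2) = k by omega]
      · rw [show 2 * (k / 2) = k - 1 by omega, show k - 1 + 1 = k by omega]
    rw [h1, pow_succ', ← Nat.div_div_eq_div_mul, show d + (n + 1) = d + 1 + n by omega,
      ← ih (d + 1) (k / 2)]
    congr 1
    refine List.map_congr_left fun e _ => ?_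
    simp only [Function.comp_apply, Nat.succ_eq_add_one, pow_succ', Nat.div_div_eq_div_mul]
    rw [show d + (e + 1) = d + 1 + e by omega]

variable {N : ℕ}

theorem leaves_fin (s : Fin N → Share) (j : Fin N) : leaves s j = some (s j) := by
  simp [leaves]

theorem fin_div_two_pow_clog (j : Fin N) : (j : ℕ) / 2 ^ Nat.clog 2 N = 0 :=
  Nat.div_eq_of_lt (j.2.trans_le (Nat.le_pow_clog (by norm_num) N))

theorem verifies_branch (s : Fin N → Share) (j : Fin N) :
    Verifies H (root H s) j (branch H s j) (s j) := by
  refine ⟨by simp [branch], ?_⟩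
  have h := climb_label (H := H) (leaves s) (Nat.clog 2 N) 0 j
  rw [fin_div_two_pow_clog, label, leaves_fin] at h
  simpa [branch, root] using h

theorem Verifies.eq_share (hH : Function.Injective H) {s : Fin N → Share} {j : Fin N}
    {b : List Digest} {σ : Share} (h : Verifies H (root H s) j b σ) : σ = s j := by
  have h1 := eq_label_of_climb_eq hH (leaves s) b _ 0 (j : ℕ) (by
    rw [h.2, h.1, fin_div_two_pow_clog, zero_add]; rfl)
  rw [label, leaves_fin] at h1
  simpa using hH h1

theorem root_injective (hH : Function.Injective H) :
    Function.Injective (root H : (Fin N → Share) → Digest) := by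
  intro s s' h
  funext j
  exact Verifies.eq_share hH (h ▸ verifies_branch (H := H) s j)

end Merkle

/-! ### DAG-rounds and parent choices -/

namespace DagUnit

variable {N : ℕ} {Data : Type u}

theorem foldr_max_le_iff (l : List ℕ) (n : ℕ) : l.foldr max 0 ≤ n ↔ ∀ x ∈ l, x ≤ n := by
  induction l with
  | nil => simp
  | cons a l ih => simp [ih]

theorem round_le_iff (U : DagUnit N Data) (n : ℕ) :
    U.round ≤ n ↔ ∀ V ∈ U.parents, V.round + 1 ≤ n := by
  obtain ⟨c, ps, d⟩ := U
  rw [round_mk, foldr_max_le_iff]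
  simp [parents]

theorem round_lt_of_mem_parents {U V : DagUnit N Data} (h : V ∈ U.parents) : V.round < U.round :=
  (round_le_iff U U.round).1 le_rfl V h

end DagUnit

theorem NodeState.exists_isParentChoice {N : ℕ} {Data : Type u} {Share : Type v} {Digest : Type w}
    (st : NodeState N Data Share Digest) (r : ℕ) : ∃ P, st.IsParentChoice r P := by
  classical
  have key : ∀ c : Fin N, (∃ W ∈ st.dag, W.creator = c ∧ W.round < r) →
      ∃ V ∈ st.dag, V.creator = c ∧ V.round < r ∧
        ∀ W ∈ st.dag, W.creator = c → W.round < r → W.round ≤ V.round := by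
    intro c hc
    let A : Set ℕ := {n | ∃ W ∈ st.dag, W.creator = c ∧ W.round < r ∧ W.round = n}
    have hA : A.Nonempty := by
      obtain ⟨W, h1, h2, h3⟩ := hc
      exact ⟨W.round, W, h1, h2, h3, rfl⟩
    have hb : BddAbove A := ⟨r, by rintro n ⟨W, -, -, h, rfl⟩; exact h.le⟩
    obtain ⟨V, h1, h2, h3, h4⟩ := Nat.sSup_mem hA hb
    exact ⟨V, h1, h2, h3, fun W w1 w2 w3 => h4 ▸ le_csSup hb ⟨W, w1, w2, w3, rfl⟩⟩
  rcases isEmpty_or_nonempty (DagUnit N Data) with _ | _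
  · exact ⟨[], by simp, by simp, fun W => isEmptyElim W⟩
  choose! g hg using key
  let L := (List.finRange N).filter fun c => decide (∃ W ∈ st.dag, W.creator = c ∧ W.round < r)
  have hL : ∀ c ∈ L, ∃ W ∈ st.dag, W.creator = c ∧ W.round < r := by
    intro c hc
    simpa [L] using hc
  refine ⟨L.map g, ?_, ?_, ?_⟩
  · rw [List.map_map]
    have : L.map (DagUnit.creator ∘ g) = L := by
      conv_rhs => rw [← List.map_id L]
      exact List.map_congr_left fun c hc => (hg c (hL c hc)).2.1
    rw [this]
    exact (List.nodup_finRange N).filter _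
  · intro V hV
    obtain ⟨c, hc, rfl⟩ := List.mem_map.1 hV
    obtain ⟨h1, h2, h3, h4⟩ := hg c (hL c hc)
    exact ⟨h1, h3, fun W w1 w2 w3 => h4 W w1 (w2.trans h2) w3⟩
  · intro W h1 h2
    have hc : W.creator ∈ L := by
      simp only [L, List.mem_filter, List.mem_finRange, true_and, decide_eq_true_eq]
      exact ⟨W, h1, rfl, h2⟩
    exact ⟨g W.creator, List.mem_map_of_mem hc, (hg _ (hL _ hc)).2.1⟩

/-! ### Invariants of the local state of an honest node -/

namespace NodeState

variable {N : ℕ} {Data : Type u} {Share : Type v} {Digest : Type w}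

/-- `st.Le st'`: all that the state `st` records is still recorded in `st'`.  The outbox, which is
emptied at the start of each atomic step, is not taken into account. -/
structure Le (st st' : NodeState N Data Share Digest) : Prop where
  rcvd : st.rcvd ⊆ st'.rcvd
  proposal : ∀ s r x, st.proposal s r = some x → st'.proposal s r = some x
  prevoted : st.prevoted ⊆ st'.prevoted
  committed : st.committed ⊆ st'.committed
  output : ∀ s r U, st.output s r = some U → st'.output s r = some U
  dag : st.dag ⊆ st'.dag
  next : st.next ≤ st'.next

theorem Le.refl (st : NodeState N Data Share Digest) : st.Le st :=
  ⟨subset_rfl, fun _ _ _ h => h, subset_rfl, subset_rfl, fun _ _ _ h => h, subset_rfl, le_rfl⟩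

theorem Le.trans {st₁ st₂ st₃ : NodeState N Data Share Digest} (h : st₁.Le st₂) (h' : st₂.Le st₃) :
    st₁.Le st₃ :=
  ⟨h.1.trans h'.1, fun s r x hx => h'.2 s r x (h.2 s r x hx), h.3.trans h'.3, h.4.trans h'.4,
    fun s r x hx => h'.5 s r x (h.5 s r x hx), h.6.trans h'.6, h.7.trans h'.7⟩

section Le

variable {st st' : NodeState N Data Share Digest}

theorem validShares_mono (h : st.rcvd ⊆ st'.rcvd) (H : Option Share ⊕ Digest × Digest → Digest)
    (s : Fin N) (r : ℕ) (d : Digest) : st.validShares H s r d ⊆ st'.validShares H s r d :=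
  fun _ ⟨b, h1, h2⟩ => ⟨b, h h1, h2⟩

theorem PrevotesFrom.mono (h : st.rcvd ⊆ st'.rcvd) {H : Option Share ⊕ Digest × Digest → Digest}
    {k : ℕ} {s : Fin N} {r : ℕ} {d : Digest} (hp : st.PrevotesFrom H k s r d) :
    st'.PrevotesFrom H k s r d := by
  obtain ⟨Q, hQ, hj⟩ := hp
  exact ⟨Q, hQ, fun j hjQ => (hj j hjQ).imp fun _ hx => validShares_mono h H s r d hx⟩

theorem CommitsFrom.mono (h : st.rcvd ⊆ st'.rcvd) {k : ℕ} {s : Fin N} {r : ℕ} {d : Digest}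
    (hp : st.CommitsFrom k s r d) : st'.CommitsFrom k s r d := by
  obtain ⟨Q, hQ, hj⟩ := hp
  exact ⟨Q, hQ, fun j hjQ => h (hj j hjQ)⟩

theorem HasOutput.mono (h : st.Le st') {U : DagUnit N Data} (hU : st.HasOutput U) :
    st'.HasOutput U := by
  obtain ⟨s, r, hsr⟩ := hU
  exact ⟨s, r, h.output s r U hsr⟩

end Le

theorem le_receive (st : NodeState N Data Share Digest) (src : Fin N)
    (m : RbcMsg N Share Digest) : st.Le (st.receive src m) := by
  refine ⟨Set.subset_insert _ _, fun s r x h => ?_, subset_rfl, subset_rfl, fun _ _ _ h => h,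
    subset_rfl, le_rfl⟩
  cases m <;> simp [receive, h]

theorem foldl_receive_rcvd (ms : List (Fin N × RbcMsg N Share Digest)) :
    ∀ st : NodeState N Data Share Digest,
      (ms.foldl (fun s m => s.receive m.1 m.2) st).rcvd = st.rcvd ∪ {m | m ∈ ms} := by
  induction ms with
  | nil => intro st; simp
  | cons m ms ih =>
    intro st
    rw [List.foldl_cons, ih]
    ext x
    simp only [receive, Set.mem_union, Set.mem_insert_iff, Set.mem_ofPred_eq, List.mem_cons]
    tauto

theorem foldl_receive_outbox (ms : List (Fin N × RbcMsg N Share Digest)) :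
    ∀ st : NodeState N Data Share Digest,
      (ms.foldl (fun s m => s.receive m.1 m.2) st).outbox = st.outbox := by
  induction ms with
  | nil => intro st; rfl
  | cons m ms ih => intro st; rw [List.foldl_cons, ih]; rfl

theorem le_foldl_receive (ms : List (Fin N × RbcMsg N Share Digest)) :
    ∀ st : NodeState N Data Share Digest, st.Le (ms.foldl (fun s m => s.receive m.1 m.2) st) := by
  induction ms with
  | nil => exact Le.refl
  | cons m ms ih => intro st; exact (le_receive st m.1 m.2).trans (ih _)

end NodeState

section Local

variable {f : ℕ} {Data : Type u} {Share : Type v} {Digest : Type w}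
  {S : Params f Data Share Digest} {i : Fin (3 * f + 1)} {inp : ℕ → Data}
  {st st' : NodeState (3 * f + 1) Data Share Digest}
  {log : Set (Fin (3 * f + 1) × RbcMsg (3 * f + 1) Share Digest)}

theorem Act.le (h : Act S i inp st st') : st.Le st' := by
  cases h with
  | create P U hwait hP hU =>
    exact ⟨subset_rfl, fun _ _ _ h => h, subset_rfl, subset_rfl, fun _ _ _ h => h,
      Set.subset_insert _ _, Nat.le_succ _⟩
  | prevote s r h b σ hprop hsize hwait hnew =>
    exact ⟨subset_rfl, fun _ _ _ h => h, Set.subset_insert _ _, subset_rfl, fun _ _ _ h => h,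
      subset_rfl, le_rfl⟩
  | commit s r h U hvotes hdec hvalid hwait hroot hnew =>
    exact ⟨subset_rfl, fun _ _ _ h => h, subset_rfl, Set.subset_insert _ _, fun _ _ _ h => h,
      subset_rfl, le_rfl⟩
  | amplify s r h hcommits hnew =>
    exact ⟨subset_rfl, fun _ _ _ h => h, subset_rfl, Set.subset_insert _ _, fun _ _ _ h => h,
      subset_rfl, le_rfl⟩
  | output s r h U hcommits hdec hnew =>
    refine ⟨subset_rfl, fun _ _ _ h => h, subset_rfl, subset_rfl, fun s' r' V hV => ?_,
      subset_rfl, le_rfl⟩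
    have : ¬ (s' = s ∧ r' = r) := by
      rintro ⟨rfl, rfl⟩
      rw [hnew] at hV
      cases hV
    simpa [this] using hV
  | attach U hout hparents hnew =>
    exact ⟨subset_rfl, fun _ _ _ h => h, subset_rfl, subset_rfl, fun _ _ _ h => h,
      Set.subset_insert _ _, le_rfl⟩

theorem Act.rcvd_eq (h : Act S i inp st st') : st'.rcvd = st.rcvd := by cases h <;> rfl

/-- The unit `C r` was created by the node `i` for the DAG-round `r`, with data `inp r`, out of the
local copy `D`, which contained the earlier units `C 0, …, C (r - 1)` of `i`. -/
structure CreatedFrom (f : ℕ) {N : ℕ} (i : Fin N) (inp : ℕ → Data) (C : ℕ → DagUnit N Data)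
    (r : ℕ) (D : Set (DagUnit N Data)) : Prop where
  creator : (C r).creator = i
  data : (C r).data = inp r
  diverse : (C r).Diverse
  wait : 0 < r → ∃ Q : Finset (DagUnit N Data), 2 * f + 1 ≤ Q.card ∧
    ∀ V ∈ Q, V ∈ D ∧ V.round + 1 = r
  maximal : ∀ V ∈ (C r).parents, V ∈ D ∧ V.round < r ∧
    ∀ W ∈ D, W.creator = V.creator → W.round < r → W.round ≤ V.round
  complete : ∀ W ∈ D, W.round < r → ∃ V ∈ (C r).parents, V.creator = W.creator
  earlier : ∀ r' < r, C r' ∈ D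

theorem CreatedFrom.congr {N : ℕ} {i : Fin N} {C C' : ℕ → DagUnit N Data} {r : ℕ}
    {D : Set (DagUnit N Data)} (h : CreatedFrom f i inp C r D) (hC : ∀ r' ≤ r, C r' = C' r') :
    CreatedFrom f i inp C' r D := by
  obtain ⟨h1, h2, h3, h4, h5, h6, h7⟩ := h
  rw [hC r le_rfl] at h1 h2 h3 h5 h6
  exact ⟨h1, h2, h3, h4, h5, h6, fun r' hr' => hC r' hr'.le ▸ h7 r' hr'⟩

/-- The proposal of the unit `U` of DAG-round `r` that an honest node sends to the node `k`. -/
def proposalMsg (S : Params f Data Share Digest) (r : ℕ) (U : DagUnit (3 * f + 1) Data)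
    (k : Fin (3 * f + 1)) : RbcMsg (3 * f + 1) Share Digest :=
  RbcMsg.propose r (Merkle.root S.hash (S.encode U)) (Merkle.branch S.hash (S.encode U) k)
    (S.encode U k)

/-- `C 0, C 1, …, C (next - 1)` are the units that the node `i` has created by the time it is in
the state `st` and has sent the messages `log`. -/
structure OwnUnits (S : Params f Data Share Digest) (i : Fin (3 * f + 1)) (inp : ℕ → Data)
    (log : Set (Fin (3 * f + 1) × RbcMsg (3 * f + 1) Share Digest))
    (st : NodeState (3 * f + 1) Data Share Digest) (C : ℕ → DagUnit (3 * f + 1) Data) : Prop where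
  mem_dag : ∀ r < st.next, C r ∈ st.dag
  created : ∀ r < st.next, ∃ D ⊆ st.dag, CreatedFrom f i inp C r D
  proposed : ∀ r < st.next, ∀ k, (k, proposalMsg S r (C r) k) ∈ log
  propose_mem : ∀ k r h b σ, (k, RbcMsg.propose r h b σ) ∈ log →
    r < st.next ∧ RbcMsg.propose r h b σ = proposalMsg S r (C r) k
  dag_cases : ∀ U ∈ st.dag, st.HasOutput U ∨ ∃ r < st.next, U = C r

/-- The conditions under which an honest node in the state `st` may have sent a commit for `h` in
the instance `(s, r)` by way of the action `commit`. -/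
def CommitReady (S : Params f Data Share Digest) (st : NodeState (3 * f + 1) Data Share Digest)
    (s : Fin (3 * f + 1)) (r : ℕ) (h : Digest) (U : DagUnit (3 * f + 1) Data) : Prop :=
  st.PrevotesFrom S.hash (2 * f + 1) s r h ∧ ValidUnit S s r U ∧
    Merkle.root S.hash (S.encode U) = h ∧ ∀ V ∈ U.parents, st.HasOutput V

theorem CommitReady.mono (hle : st.Le st') {s : Fin (3 * f + 1)} {r : ℕ} {h : Digest}
    {U : DagUnit (3 * f + 1) Data} (hc : CommitReady S st s r h U) : CommitReady S st' s r h U :=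
  ⟨hc.1.mono hle.rcvd, hc.2.1, hc.2.2.1, fun V hV => (hc.2.2.2 V hV).mono hle⟩

/-- The unit `U` is backed in the state `st` by `2f+1` commits for `h` in the instance `(s, r)` and
by `f+1` of its own shares that are valid for `h`. -/
def OutputReady (S : Params f Data Share Digest) (st : NodeState (3 * f + 1) Data Share Digest)
    (s : Fin (3 * f + 1)) (r : ℕ) (h : Digest) (U : DagUnit (3 * f + 1) Data) : Prop :=
  st.CommitsFrom (2 * f + 1) s r h ∧ ∃ Q : Finset (Fin (3 * f + 1)), f + 1 ≤ Q.card ∧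
    ∀ j ∈ Q, (j, S.encode U j) ∈ st.validShares S.hash s r h

theorem OutputReady.mono (hle : st.rcvd ⊆ st'.rcvd) {s : Fin (3 * f + 1)} {r : ℕ} {h : Digest}
    {U : DagUnit (3 * f + 1) Data} (hc : OutputReady S st s r h U) : OutputReady S st' s r h U := by
  obtain ⟨h1, Q, hQ, h2⟩ := hc
  exact ⟨h1.mono hle, Q, hQ, fun j hj => NodeState.validShares_mono hle _ _ _ _ (h2 j hj)⟩

/-- The invariant of the honest node `i` in the state `st`, where `log` is the set of all messages
sent by `i` so far, with their recipients. -/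
structure LocalInv (S : Params f Data Share Digest) (i : Fin (3 * f + 1)) (inp : ℕ → Data)
    (log : Set (Fin (3 * f + 1) × RbcMsg (3 * f + 1) Share Digest))
    (st : NodeState (3 * f + 1) Data Share Digest) : Prop where
  rcvd_of_proposal : ∀ s r h b σ, st.proposal s r = some (h, b, σ) →
    (s, RbcMsg.propose r h b σ) ∈ st.rcvd
  proposal_of_rcvd : ∀ s r h b σ, (s, RbcMsg.propose r h b σ) ∈ st.rcvd →
    ∃ x, st.proposal s r = some x
  prevote_of_prevoted : ∀ s r, (s, r) ∈ st.prevoted →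
    ∃ h b σ, ∀ k, (k, RbcMsg.prevote s r h b σ) ∈ log
  prevoted_of_prevote : ∀ k s r h b σ, (k, RbcMsg.prevote s r h b σ) ∈ log →
    (s, r) ∈ st.prevoted ∧ st.proposal s r = some (h, b, σ)
  commit_of_committed : ∀ s r, (s, r) ∈ st.committed → ∃ h, ∀ k, (k, RbcMsg.commit s r h) ∈ log
  ready_of_commit : ∀ k s r h, (k, RbcMsg.commit s r h) ∈ log →
    (∀ k', (k', RbcMsg.commit s r h) ∈ log) ∧
      ((∃ U, CommitReady S st s r h U) ∨ st.CommitsFrom (f + 1) s r h)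
  ready_of_output : ∀ s r U, st.output s r = some U → ∃ h, OutputReady S st s r h U
  closed : ∀ U ∈ st.dag, ∀ V ∈ U.parents, V ∈ st.dag
  own : ∃ C, OwnUnits S i inp log st C

theorem localInv_initial : LocalInv S i inp ∅ NodeState.initial where
  rcvd_of_proposal := by intro s r h b σ hp; simp [NodeState.initial] at hp
  proposal_of_rcvd := by intro s r h b σ hp; simp [NodeState.initial] at hp
  prevote_of_prevoted := by intro s r hp; simp [NodeState.initial] at hp
  prevoted_of_prevote := by intro k s r h b σ hp; simp at hp
  commit_of_committed := by intro s r hp; simp [NodeState.initial] at hp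
  ready_of_commit := by intro k s r h hp; simp at hp
  ready_of_output := by intro s r U hp; simp [NodeState.initial] at hp
  closed := by intro U hU; simp [NodeState.initial] at hU
  own := ⟨fun _ => DagUnit.mk i [] (inp 0), by simp [NodeState.initial],
    by simp [NodeState.initial], by simp [NodeState.initial], by simp, by simp [NodeState.initial]⟩

theorem LocalInv.clear_outbox (h : LocalInv S i inp log st) :
    LocalInv S i inp log { st with outbox := [] } := by
  obtain ⟨h1, h2, h3, h4, h5, h6, h7, h8, C, c1, c2, c3, c4, c5⟩ := h
  exact ⟨h1, h2, h3, h4, h5, h6, h7, h8, C, c1, c2, c3, c4, c5⟩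

theorem LocalInv.receive (h : LocalInv S i inp log st) (src : Fin (3 * f + 1))
    (m : RbcMsg (3 * f + 1) Share Digest) : LocalInv S i inp log (st.receive src m) := by
  have hle := st.le_receive src m
  obtain ⟨h1, h2, h3, h4, h5, h6, h7, h8, C, c1, c2, c3, c4, c5⟩ := h
  refine ⟨?_, ?_, h3, ?_, h5, ?_, ?_, h8, C, c1, c2, c3, c4, c5⟩
  · intro s r d b σ hp
    cases hps : st.proposal s r with
    | some x =>
      rw [hle.proposal s r x hps] at hp
      cases hp
      exact hle.rcvd (h1 s r _ _ _ hps)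
    | none =>
      cases m with
      | propose r' d' b' σ' =>
        simp only [NodeState.receive, hps, Option.none_or] at hp
        split_ifs at hp with hc
        obtain ⟨rfl, rfl⟩ := hc
        cases hp
        exact Set.mem_insert _ _
      | prevote => simp [NodeState.receive, hps] at hp
      | commit => simp [NodeState.receive, hps] at hp
  · intro s r d b σ hp
    rcases hp with hp | hp
    · cases hp
      cases hps : st.proposal src r with
      | some x => exact ⟨x, hle.proposal _ _ _ hps⟩
      | none => exact ⟨(d, b, σ), by simp [NodeState.receive, hps]⟩
    · obtain ⟨x, hx⟩ := h2 s r d b σ hp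
      exact ⟨x, hle.proposal _ _ _ hx⟩
  · intro k s r d b σ hp
    exact ⟨(h4 k s r d b σ hp).1, hle.proposal _ _ _ (h4 k s r d b σ hp).2⟩
  · intro k s r d hp
    exact And.imp_right (Or.imp (fun ⟨U, hU⟩ => ⟨U, hU.mono hle⟩) fun h => h.mono hle.rcvd)
      (h6 k s r d hp)
  · intro s r U hU
    exact (h7 s r U hU).imp fun _ h => h.mono hle.rcvd

theorem LocalInv.foldl_receive (ms : List (Fin (3 * f + 1) × RbcMsg (3 * f + 1) Share Digest)) :
    ∀ {st : NodeState (3 * f + 1) Data Share Digest}, LocalInv S i inp log st →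
      LocalInv S i inp log (ms.foldl (fun s m => s.receive m.1 m.2) st) := by
  induction ms with
  | nil => exact id
  | cons m ms ih => intro st h; exact ih (h.receive m.1 m.2)

theorem mem_multicast {N : ℕ} (k : Fin N) (m m' : RbcMsg N Share Digest) :
    (k, m') ∈ NodeState.multicast m ↔ m' = m := by
  simp [NodeState.multicast, eq_comm]

theorem OwnUnits.create {C : ℕ → DagUnit (3 * f + 1) Data} (h : OwnUnits S i inp log st C)
    {P : List (DagUnit (3 * f + 1) Data)}
    (hwait : 0 < st.next → ∃ Q : Finset (DagUnit (3 * f + 1) Data), 2 * f + 1 ≤ Q.card ∧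
      ∀ V ∈ Q, V ∈ st.dag ∧ V.round + 1 = st.next)
    (hP : st.IsParentChoice st.next P)
    {log' : Set (Fin (3 * f + 1) × RbcMsg (3 * f + 1) Share Digest)}
    (hlog : ∀ k m, (k, m) ∈ log' ↔
      (k, m) ∈ log ∨ m = proposalMsg S st.next (DagUnit.mk i P (inp st.next)) k)
    (hst' : st' = { st with
      dag := insert (DagUnit.mk i P (inp st.next)) st.dag
      next := st.next + 1
      outbox := st'.outbox }) :
    ∃ C', OwnUnits S i inp log' st' C' := by
  set U := DagUnit.mk i P (inp st.next) with hU
  have hlt : ∀ r < st.next, C r = Function.update C st.next U r := fun r hr => by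
    rw [Function.update_of_ne hr.ne]
  have hself : Function.update C st.next U st.next = U := Function.update_self ..
  have hdag : st'.dag = insert U st.dag := by rw [hst']
  have hnext : st'.next = st.next + 1 := by rw [hst']
  have hout : st'.output = st.output := by rw [hst']
  refine ⟨Function.update C st.next U, ?_, ?_, ?_, ?_, ?_⟩
  · intro r hr
    rw [hdag]
    rcases Nat.lt_succ_iff_lt_or_eq.1 (hnext ▸ hr) with hr | rfl
    · exact hlt r hr ▸ Set.mem_insert_of_mem _ (h.mem_dag r hr)
    · exact hself.symm ▸ Set.mem_insert _ _
  · intro r hr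
    rw [hdag]
    rcases Nat.lt_succ_iff_lt_or_eq.1 (hnext ▸ hr) with hr | rfl
    · obtain ⟨D, hD, hc⟩ := h.created r hr
      exact ⟨D, hD.trans (Set.subset_insert _ _), hc.congr fun r' hr' => hlt r' (hr'.trans_lt hr)⟩
    · refine ⟨st.dag, Set.subset_insert _ _, ?_⟩
      constructor
      · rw [hself]; rfl
      · rw [hself]; rfl
      · rw [hself]; exact hP.1
      · exact hwait
      · rw [hself]; exact hP.2.1
      · rw [hself]; exact hP.2.2
      · intro r' hr'; exact hlt r' hr' ▸ h.mem_dag r' hr'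
  · intro r hr k
    rw [hlog]
    rcases Nat.lt_succ_iff_lt_or_eq.1 (hnext ▸ hr) with hr | rfl
    · exact Or.inl (hlt r hr ▸ h.proposed r hr k)
    · exact Or.inr (by rw [hself])
  · intro k r d b σ hm
    rw [hnext]
    rcases (hlog _ _).1 hm with hm | hm
    · obtain ⟨h1, h2⟩ := h.propose_mem k r d b σ hm
      exact ⟨h1.trans (Nat.lt_succ_self _), hlt r h1 ▸ h2⟩
    · have hr : r = st.next := by
        rw [proposalMsg, RbcMsg.propose.injEq] at hm
        exact hm.1
      subst hr
      exact ⟨Nat.lt_succ_self _, by rw [hself]; exact hm⟩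
  · intro V hV
    rw [hdag] at hV
    rcases hV with rfl | hV
    · exact Or.inr ⟨st.next, by omega, hself.symm⟩
    · rcases h.dag_cases V hV with ⟨s, r, ho⟩ | ⟨r, hr, hV⟩
      · exact Or.inl ⟨s, r, by rw [hout]; exact ho⟩
      · exact Or.inr ⟨r, by omega, hlt r hr ▸ hV⟩

/-- Actions other than `create` preserve the list of own units. -/
theorem OwnUnits.mono {C : ℕ → DagUnit (3 * f + 1) Data} (h : OwnUnits S i inp log st C)
    (hle : st.Le st') (hnext : st'.next = st.next)
    {log' : Set (Fin (3 * f + 1) × RbcMsg (3 * f + 1) Share Digest)} (hlog : log ⊆ log')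
    (hlog' : ∀ k r h b σ, (k, RbcMsg.propose r h b σ) ∈ log' → (k, RbcMsg.propose r h b σ) ∈ log)
    (hdag : ∀ U ∈ st'.dag, U ∈ st.dag ∨ st'.HasOutput U) :
    OwnUnits S i inp log' st' C where
  mem_dag := fun r hr => hle.dag (h.mem_dag r (hnext ▸ hr))
  created := fun r hr => by
    obtain ⟨D, hD, hc⟩ := h.created r (hnext ▸ hr)
    exact ⟨D, hD.trans hle.dag, hc⟩
  proposed := fun r hr k => hlog (h.proposed r (hnext ▸ hr) k)
  propose_mem := fun k r d b σ hm => hnext ▸ h.propose_mem k r d b σ (hlog' k r d b σ hm)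
  dag_cases := fun U hU => by
    rcases hdag U hU with hU | hU
    · rw [hnext]
      exact (h.dag_cases U hU).imp_left fun ho => ho.mono hle
    · exact Or.inl hU

theorem Act.exists_outbox (hact : Act S i inp st st') :
    ∃ new, st'.outbox = st.outbox ++ new ∧
      ∀ log, LocalInv S i inp log st → LocalInv S i inp (log ∪ {m | m ∈ new}) st' := by
  have hle := hact.le
  cases hact with
  | create P U hwait hP hU =>
    refine ⟨_, rfl, fun log h => ?_⟩
    subst hU
    obtain ⟨h1, h2, h3, h4, h5, h6, h7, h8, C, hC⟩ := h
    refine ⟨h1, h2, ?_, ?_, ?_, ?_, h7, ?_, ?_⟩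
    · intro s r hp
      obtain ⟨d, b, σ, hk⟩ := h3 s r hp
      exact ⟨d, b, σ, fun k => Or.inl (hk k)⟩
    · intro k s r d b σ hp
      rcases hp with hp | hp
      · exact h4 k s r d b σ hp
      · simp at hp
    · intro s r hp
      obtain ⟨d, hk⟩ := h5 s r hp
      exact ⟨d, fun k => Or.inl (hk k)⟩
    · intro k s r d hp
      rcases hp with hp | hp
      · exact And.imp_left (fun hk k' => Or.inl (hk k')) (h6 k s r d hp)
      · simp at hp
    · rintro V (rfl | hV) W hW
      · exact Set.mem_insert_of_mem _ (hP.2.1 W hW).1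
      · exact Set.mem_insert_of_mem _ (h8 V hV W hW)
    · refine hC.create hwait hP (fun k m => ?_) rfl
      simp only [Set.mem_union, Set.mem_ofPred_eq, List.mem_map, List.mem_finRange, true_and,
        Prod.mk.injEq, exists_eq_left, proposalMsg, @eq_comm _ m]
  | prevote s r h b σ hprop hsize hwait hnew =>
    refine ⟨_, rfl, fun log hinv => ?_⟩
    obtain ⟨h1, h2, h3, h4, h5, h6, h7, h8, C, hC⟩ := hinv
    refine ⟨h1, h2, ?_, ?_, ?_, ?_, h7, h8, C, hC.mono hle rfl Set.subset_union_left ?_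
      fun U hU => Or.inl hU⟩
    · rintro s' r' (hp | hp)
      · cases hp
        exact ⟨h, b, σ, fun k => Or.inr ((mem_multicast _ _ _).2 rfl)⟩
      · obtain ⟨d, b, σ, hk⟩ := h3 s' r' hp
        exact ⟨d, b, σ, fun k => Or.inl (hk k)⟩
    · intro k s' r' d b' σ' hp
      rcases hp with hp | hp
      · exact ⟨Set.mem_insert_of_mem _ (h4 k s' r' d b' σ' hp).1, (h4 k s' r' d b' σ' hp).2⟩
      · cases (mem_multicast _ _ _).1 hp
        exact ⟨Set.mem_insert _ _, hprop⟩
    · intro s r hp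
      obtain ⟨d, hk⟩ := h5 s r hp
      exact ⟨d, fun k => Or.inl (hk k)⟩
    · intro k s r d hp
      rcases hp with hp | hp
      · exact And.imp_left (fun hk k' => Or.inl (hk k')) (h6 k s r d hp)
      · cases (mem_multicast _ _ _).1 hp
    · intro k r d b σ hp
      rcases hp with hp | hp
      · exact hp
      · cases (mem_multicast _ _ _).1 hp
  | commit s r h U hvotes hdec hvalid hwait hroot hnew =>
    refine ⟨_, rfl, fun log hinv => ?_⟩
    obtain ⟨h1, h2, h3, h4, h5, h6, h7, h8, C, hC⟩ := hinv
    refine ⟨h1, h2, ?_, ?_, ?_, ?_, h7, h8, C, hC.mono hle rfl Set.subset_union_left ?_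
      fun U hU => Or.inl hU⟩
    · intro s r hp
      obtain ⟨d, b, σ, hk⟩ := h3 s r hp
      exact ⟨d, b, σ, fun k => Or.inl (hk k)⟩
    · intro k s r d b σ hp
      rcases hp with hp | hp
      · exact h4 k s r d b σ hp
      · cases (mem_multicast _ _ _).1 hp
    · rintro s' r' (hp | hp)
      · cases hp
        exact ⟨h, fun k => Or.inr ((mem_multicast _ _ _).2 rfl)⟩
      · obtain ⟨d, hk⟩ := h5 s' r' hp
        exact ⟨d, fun k => Or.inl (hk k)⟩
    · intro k s' r' d hp
      rcases hp with hp | hp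
      · exact And.imp_left (fun hk k' => Or.inl (hk k')) (h6 k s' r' d hp)
      · cases (mem_multicast _ _ _).1 hp
        exact ⟨fun k' => Or.inr ((mem_multicast _ _ _).2 rfl), Or.inl ⟨U, hvotes, hvalid, hroot, hwait⟩⟩
    · intro k r d b σ hp
      rcases hp with hp | hp
      · exact hp
      · cases (mem_multicast _ _ _).1 hp
  | amplify s r h hcommits hnew =>
    refine ⟨_, rfl, fun log hinv => ?_⟩
    obtain ⟨h1, h2, h3, h4, h5, h6, h7, h8, C, hC⟩ := hinv
    refine ⟨h1, h2, ?_, ?_, ?_, ?_, h7, h8, C, hC.mono hle rfl Set.subset_union_left ?_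
      fun U hU => Or.inl hU⟩
    · intro s r hp
      obtain ⟨d, b, σ, hk⟩ := h3 s r hp
      exact ⟨d, b, σ, fun k => Or.inl (hk k)⟩
    · intro k s r d b σ hp
      rcases hp with hp | hp
      · exact h4 k s r d b σ hp
      · cases (mem_multicast _ _ _).1 hp
    · rintro s' r' (hp | hp)
      · cases hp
        exact ⟨h, fun k => Or.inr ((mem_multicast _ _ _).2 rfl)⟩
      · obtain ⟨d, hk⟩ := h5 s' r' hp
        exact ⟨d, fun k => Or.inl (hk k)⟩
    · intro k s' r' d hp
      rcases hp with hp | hp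
      · exact And.imp_left (fun hk k' => Or.inl (hk k')) (h6 k s' r' d hp)
      · cases (mem_multicast _ _ _).1 hp
        exact ⟨fun k' => Or.inr ((mem_multicast _ _ _).2 rfl), Or.inr hcommits⟩
    · intro k r d b σ hp
      rcases hp with hp | hp
      · exact hp
      · cases (mem_multicast _ _ _).1 hp
  | output s r h U hcommits hdec hnew =>
    refine ⟨[], by simp, fun log hinv => ?_⟩
    obtain ⟨h1, h2, h3, h4, h5, h6, h7, h8, C, hC⟩ := hinv
    simp only [List.not_mem_nil, Set.ofPred_false, Set.union_empty]
    refine ⟨h1, h2, h3, h4, h5, ?_, ?_, h8, C, hC.mono hle rfl subset_rfl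
      (fun _ _ _ _ _ hp => hp) fun U hU => Or.inl hU⟩
    · intro k s' r' d hp
      exact And.imp_right (Or.imp_left fun ⟨U, hU⟩ => ⟨U, hU.mono hle⟩) (h6 k s' r' d hp)
    · intro s' r' V hV
      simp only at hV
      split_ifs at hV with hc
      · cases hV
        obtain ⟨rfl, rfl⟩ := hc
        obtain ⟨⟨Q, hQ, hj⟩, hall⟩ := hdec
        refine ⟨h, hcommits, Q, hQ, fun j hjQ => ?_⟩
        obtain ⟨σ, hσ⟩ := hj j hjQ
        rw [hall _ hσ]
        exact hσ
      · exact h7 s' r' V hV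
  | attach U hout hparents hnew =>
    refine ⟨[], by simp, fun log hinv => ?_⟩
    obtain ⟨h1, h2, h3, h4, h5, h6, h7, h8, C, hC⟩ := hinv
    simp only [List.not_mem_nil, Set.ofPred_false, Set.union_empty]
    refine ⟨h1, h2, h3, h4, h5, h6, h7, ?_, C, hC.mono hle rfl subset_rfl
      (fun _ _ _ _ _ hp => hp) ?_⟩
    · rintro V (rfl | hV) W hW
      · exact Set.mem_insert_of_mem _ (hparents W hW)
      · exact Set.mem_insert_of_mem _ (h8 V hV W hW)
    · rintro V (rfl | hV)
      · exact Or.inr hout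
      · exact Or.inl hV

theorem reflTransGen_act_exists_outbox (h : Relation.ReflTransGen (Act S i inp) st st') :
    st.Le st' ∧ st'.rcvd = st.rcvd ∧ ∃ new, st'.outbox = st.outbox ++ new ∧
      ∀ log, LocalInv S i inp log st → LocalInv S i inp (log ∪ {m | m ∈ new}) st' := by
  induction h with
  | refl => exact ⟨.refl _, rfl, [], by simp, fun log h => by simpa using h⟩
  | tail _ hact ih =>
    obtain ⟨h1, h2, new, hnew, hinv⟩ := ih
    obtain ⟨new', hnew', hinv'⟩ := hact.exists_outbox
    refine ⟨h1.trans hact.le, hact.rcvd_eq.trans h2, new ++ new', by simp [hnew', hnew],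
      fun log h => ?_⟩
    convert hinv' _ (hinv log h) using 1
    ext m
    simp [or_assoc]

theorem HonestStep.le {ms : List (Fin (3 * f + 1) × RbcMsg (3 * f + 1) Share Digest)}
    (h : HonestStep S i inp ms st st') : st.Le st' := by
  have h1 : st.Le { st with outbox := [] } :=
    ⟨subset_rfl, fun _ _ _ h => h, subset_rfl, subset_rfl, fun _ _ _ h => h, subset_rfl, le_rfl⟩
  exact (h1.trans (NodeState.le_foldl_receive ms _)).trans (reflTransGen_act_exists_outbox h.1).1

theorem HonestStep.rcvd_eq {ms : List (Fin (3 * f + 1) × RbcMsg (3 * f + 1) Share Digest)}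
    (h : HonestStep S i inp ms st st') : st'.rcvd = st.rcvd ∪ {m | m ∈ ms} := by
  rw [(reflTransGen_act_exists_outbox h.1).2.1, NodeState.foldl_receive_rcvd]

theorem HonestStep.localInv {ms : List (Fin (3 * f + 1) × RbcMsg (3 * f + 1) Share Digest)}
    (h : HonestStep S i inp ms st st') (hinv : LocalInv S i inp log st) :
    LocalInv S i inp (log ∪ {m | m ∈ st'.outbox}) st' := by
  obtain ⟨-, -, new, hnew, hstep⟩ := reflTransGen_act_exists_outbox h.1
  rw [NodeState.foldl_receive_outbox, List.nil_append] at hnew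
  rw [hnew]
  exact hstep log (hinv.clear_outbox.foldl_receive ms)

end Local

/-! ### Counting nodes -/

section Quorum

variable {f : ℕ} {byz : Finset (Fin (3 * f + 1))}

theorem exists_honest_of_card (hbyz : byz.card ≤ f) {Q : Finset (Fin (3 * f + 1))}
    (hQ : f + 1 ≤ Q.card) : ∃ j ∈ Q, j ∉ byz := by
  by_contra! h
  have := Finset.card_le_card h
  omega

theorem card_honest_of_card (hbyz : byz.card ≤ f) {Q : Finset (Fin (3 * f + 1))}
    (hQ : 2 * f + 1 ≤ Q.card) : f + 1 ≤ (Q \ byz).card := by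
  have := Finset.le_card_sdiff byz Q
  omega

theorem card_honest (hbyz : byz.card ≤ f) : 2 * f + 1 ≤ (byzᶜ).card := by
  rw [Finset.card_compl, Fintype.card_fin]
  omega

theorem exists_honest_of_quorums (hbyz : byz.card ≤ f) {Q Q' : Finset (Fin (3 * f + 1))}
    (hQ : 2 * f + 1 ≤ Q.card) (hQ' : 2 * f + 1 ≤ Q'.card) : ∃ j ∈ Q, j ∈ Q' ∧ j ∉ byz := by
  have h1 := Finset.card_union_add_card_inter Q Q'
  have h2 : (Q ∪ Q').card ≤ 3 * f + 1 := by
    simpa using Finset.card_le_univ (Q ∪ Q')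
  obtain ⟨j, hj, hj'⟩ := exists_honest_of_card hbyz (Q := Q ∩ Q') (by omega)
  exact ⟨j, (Finset.mem_inter.1 hj).1, (Finset.mem_inter.1 hj).2, hj'⟩

end Quorum

/-! ### Honest nodes in an execution -/

namespace Execution

variable {f : ℕ} {Data : Type u} {Share : Type v} {Digest : Type w}
  {S : Params f Data Share Digest} {byz : Finset (Fin (3 * f + 1))} (E : Execution S byz)

/-- The messages sent by the node `i` before the atomic step `t`, with their recipients. -/
def log (i : Fin (3 * f + 1)) (t : ℕ) : Set (Fin (3 * f + 1) × RbcMsg (3 * f + 1) Share Digest) :=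
  {m | ∃ τ < t, E.actor τ = i ∧ m ∈ E.sent τ}

variable {E} {i j k s : Fin (3 * f + 1)} {t t' r r' : ℕ}

theorem log_mono (h : t ≤ t') : E.log i t ⊆ E.log i t' :=
  fun _ ⟨τ, h1, h2⟩ => ⟨τ, h1.trans_le h, h2⟩

theorem localInv (hi : i ∉ byz) (t : ℕ) :
    LocalInv S i (E.input i) (E.log i t) (E.state t i) := by
  induction t with
  | zero =>
    rw [E.state_zero i hi]
    convert localInv_initial (S := S) (i := i) (inp := E.input i)
    ext m
    simp [log]
  | succ t ih =>
    by_cases hact : i = E.actor t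
    · subst hact
      convert (E.state_act t hi).localInv ih using 1
      ext m
      rw [← E.sent_honest t hi]
      simp only [log, Nat.lt_succ_iff_lt_or_eq, Set.mem_union, Set.mem_ofPred_eq]
      constructor
      · rintro ⟨τ, h1 | rfl, h2, h3⟩
        · exact Or.inl ⟨τ, h1, h2, h3⟩
        · exact Or.inr h3
      · rintro (⟨τ, h1, h2, h3⟩ | h)
        · exact ⟨τ, Or.inl h1, h2, h3⟩
        · exact ⟨t, Or.inr rfl, rfl, h⟩
    · rw [E.state_idle t i hi hact]
      convert ih using 1
      ext m
      simp only [log, Nat.lt_succ_iff_lt_or_eq, Set.mem_ofPred_eq]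
      constructor
      · rintro ⟨τ, h1 | rfl, h2, h3⟩
        · exact ⟨τ, h1, h2, h3⟩
        · exact absurd h2.symm hact
      · rintro ⟨τ, h1, h2⟩
        exact ⟨τ, Or.inl h1, h2⟩

theorem state_le (hi : i ∉ byz) (h : t ≤ t') : (E.state t i).Le (E.state t' i) := by
  induction h with
  | refl => exact .refl _
  | @step t' _ ih =>
    refine ih.trans ?_
    by_cases hact : i = E.actor t'
    · subst hact
      exact (E.state_act t' hi).le
    · rw [E.state_idle t' i hi hact]
      exact .refl _

/-- Once it has acted, an honest node is always in a state in which no action is possible. -/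
theorem not_act (hi : i ∉ byz) {t₀ : ℕ} (hact : E.actor t₀ = i) (h : t₀ < t) :
    ∀ st, ¬ Act S i (E.input i) (E.state t i) st := by
  induction t with
  | zero => omega
  | succ t ih =>
    by_cases hact' : i = E.actor t
    · subst hact'
      exact (E.state_act t hi).2
    · rw [E.state_idle t i hi hact']
      refine ih (lt_of_le_of_ne (Nat.lt_succ_iff.1 h) ?_)
      rintro rfl
      exact hact' hact.symm

theorem mem_log_of_mem_rcvd (hi : i ∉ byz) {m : RbcMsg (3 * f + 1) Share Digest}
    (h : (k, m) ∈ (E.state t i).rcvd) : ∃ t' < t, (i, m) ∈ E.log k t' := by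
  induction t with
  | zero => rw [E.state_zero i hi] at h; simp [NodeState.initial] at h
  | succ t ih =>
    have lift : (∃ t' < t, (i, m) ∈ E.log k t') → ∃ t' < t + 1, (i, m) ∈ E.log k t' :=
      fun ⟨t', h1, h2⟩ => ⟨t', h1.trans (Nat.lt_succ_self t), h2⟩
    by_cases hact : i = E.actor t
    · subst hact
      rw [(E.state_act t hi).rcvd_eq] at h
      rcases h with h | h
      · exact lift (ih h)
      · obtain ⟨p, hp, hpm⟩ := List.mem_map.1 h
        obtain ⟨h1, h2, h3, -⟩ := E.delivered_pending t p hp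
        cases hpm
        exact ⟨p.sentAt + 1, by omega, p.sentAt, Nat.lt_succ_self _, rfl, h1 ▸ h3⟩
    · rw [E.state_idle t i hi hact] at h
      exact lift (ih h)

theorem mem_rcvd_of_delivered {p : Packet (3 * f + 1) Share Digest} (hi : p.dst ∉ byz)
    (hp : p ∈ E.delivered t) (h : t < t') :
    (E.actor p.sentAt, p.msg) ∈ (E.state t' p.dst).rcvd := by
  have hdst := (E.delivered_pending t p hp).1
  refine (state_le hi (Nat.succ_le_of_lt h)).rcvd ?_
  rw [hdst] at hi ⊢
  rw [(E.state_act t hi).rcvd_eq]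
  exact Or.inr (List.mem_map.2 ⟨p, hp, rfl⟩)

/-! ### Units certified by an honest commit -/

variable (E) in
/-- Some honest node was in a position to commit for `h` in the instance `(s, r)`, with
reconstructed unit `U`, before the atomic step `t`. -/
def Certified (s : Fin (3 * f + 1)) (r : ℕ) (h : Digest) (U : DagUnit (3 * f + 1) Data) (t : ℕ) :
    Prop :=
  ∃ i, i ∉ byz ∧ CommitReady S (E.state t i) s r h U

theorem Certified.mono {h : Digest} {U : DagUnit (3 * f + 1) Data} (hc : E.Certified s r h U t)
    (ht : t ≤ t') : E.Certified s r h U t' := by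
  obtain ⟨i, hi, hr⟩ := hc
  exact ⟨i, hi, hr.mono (state_le hi ht)⟩

theorem Certified.validUnit {h : Digest} {U : DagUnit (3 * f + 1) Data}
    (hc : E.Certified s r h U t) : ValidUnit S s r U := by
  obtain ⟨i, -, -, hv, -⟩ := hc
  exact hv

theorem Certified.root_eq {h : Digest} {U : DagUnit (3 * f + 1) Data}
    (hc : E.Certified s r h U t) : Merkle.root S.hash (S.encode U) = h := by
  obtain ⟨i, -, -, -, hr, -⟩ := hc
  exact hr

theorem encode_injective (S : Params f Data Share Digest) : Function.Injective S.encode := by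
  intro U V h
  refine S.encode_inj U V Finset.univ ?_ fun j _ => by rw [h]
  rw [Finset.card_univ, Fintype.card_fin]
  omega

theorem root_encode_injective (S : Params f Data Share Digest) :
    Function.Injective fun U => Merkle.root S.hash (S.encode U) :=
  (Merkle.root_injective S.hash_inj).comp (encode_injective S)

/-- The first honest node to commit for `h` did so by the action `commit`, since `f+1` commits
include an honest one. -/
theorem exists_certified_of_commit (hbyz : byz.card ≤ f) (hi : i ∉ byz) {h : Digest}
    (hm : (k, RbcMsg.commit s r h) ∈ E.log i t) : ∃ U, E.Certified s r h U t := by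
  induction t using Nat.strong_induction_on generalizing i k with
  | _ t ih =>
    rcases ((localInv hi t).ready_of_commit k s r h hm).2 with ⟨U, hU⟩ | ⟨Q, hQ, hj⟩
    · exact ⟨U, i, hi, hU⟩
    · obtain ⟨j, hjQ, hjb⟩ := exists_honest_of_card hbyz hQ
      obtain ⟨t', ht', hm'⟩ := mem_log_of_mem_rcvd hi (hj j hjQ)
      exact (ih t' ht' hjb hm').imp fun U hU => hU.mono ht'.le

/-- An honest node sends every prevote to all nodes. -/
theorem multicast_of_prevote (hi : i ∉ byz) {h : Digest} {b : List Digest} {σ : Share}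
    (hm : (k, RbcMsg.prevote s r h b σ) ∈ E.log i t) (k' : Fin (3 * f + 1)) :
    (k', RbcMsg.prevote s r h b σ) ∈ E.log i t := by
  have hinv := localInv (E := E) hi t
  obtain ⟨h1, h2⟩ := hinv.prevoted_of_prevote _ _ _ _ _ _ hm
  obtain ⟨h', b', σ', hk⟩ := hinv.prevote_of_prevoted _ _ h1
  have h3 := (hinv.prevoted_of_prevote _ _ _ _ _ _ (hk k')).2
  rw [h2] at h3
  cases h3
  exact hk k'

theorem exists_prevote_of_prevotesFrom (hi : i ∉ byz) {h : Digest} {n : ℕ}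
    (hp : (E.state t i).PrevotesFrom S.hash n s r h) :
    ∃ Q : Finset (Fin (3 * f + 1)), n ≤ Q.card ∧ ∀ j ∈ Q, ∃ b σ,
      Merkle.Verifies S.hash h j b σ ∧ (i, RbcMsg.prevote s r h b σ) ∈ E.log j t := by
  obtain ⟨Q, hQ, hj⟩ := hp
  refine ⟨Q, hQ, fun j hjQ => ?_⟩
  obtain ⟨σ, b, h1, h2⟩ := hj j hjQ
  obtain ⟨t', ht', hm⟩ := mem_log_of_mem_rcvd hi h1
  exact ⟨b, σ, h2, log_mono ht'.le hm⟩

/-- Two quorums of prevotes share an honest node, which prevotes once per instance. -/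
theorem Certified.unique (hbyz : byz.card ≤ f) {h h' : Digest} {U U' : DagUnit (3 * f + 1) Data}
    (hc : E.Certified s r h U t) (hc' : E.Certified s r h' U' t') : h = h' ∧ U = U' := by
  have hh : h = h' := by
    obtain ⟨i, hi, hp, -⟩ := hc.mono (le_max_left t t')
    obtain ⟨i', hi', hp', -⟩ := hc'.mono (le_max_right t t')
    obtain ⟨Q, hQ, hj⟩ := exists_prevote_of_prevotesFrom hi hp
    obtain ⟨Q', hQ', hj'⟩ := exists_prevote_of_prevotesFrom hi' hp'
    obtain ⟨j, h1, h2, hjb⟩ := exists_honest_of_quorums hbyz hQ hQ'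
    obtain ⟨b, σ, -, hm⟩ := hj j h1
    obtain ⟨b', σ', -, hm'⟩ := hj' j h2
    have e := ((localInv hjb _).prevoted_of_prevote _ _ _ _ _ _ hm).2
    rw [((localInv hjb _).prevoted_of_prevote _ _ _ _ _ _ hm').2] at e
    cases e
    rfl
  refine ⟨hh, root_encode_injective S ?_⟩
  exact (hc.root_eq.trans hh).trans hc'.root_eq.symm

theorem eq_share_of_mem_validShares {st : NodeState (3 * f + 1) Data Share Digest}
    {U : DagUnit (3 * f + 1) Data} {x : Fin (3 * f + 1) × Share}
    (h : x ∈ st.validShares S.hash s r (Merkle.root S.hash (S.encode U))) :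
    S.encode U x.1 = x.2 := by
  obtain ⟨b, -, hv⟩ := h
  exact (hv.eq_share S.hash_inj).symm

/-- The decoder of a local output need not compare Merkle roots: `f+1` shares valid for the root of
a certified unit are shares of that unit, and so determine it. -/
theorem exists_certified_of_output (hbyz : byz.card ≤ f) (hi : i ∉ byz)
    {U : DagUnit (3 * f + 1) Data} (ho : (E.state t i).output s r = some U) :
    ∃ h, E.Certified s r h U t ∧ (E.state t i).CommitsFrom (2 * f + 1) s r h := by
  obtain ⟨h, hcom, Q', hQ', hsh⟩ := (localInv hi t).ready_of_output s r U ho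
  have hcom' := hcom
  obtain ⟨Q, hQ, hj⟩ := hcom'
  obtain ⟨j, hjQ, hjb⟩ := exists_honest_of_card hbyz (Q := Q) (by omega)
  obtain ⟨t', ht', hm⟩ := mem_log_of_mem_rcvd hi (hj j hjQ)
  obtain ⟨V, hV⟩ := exists_certified_of_commit hbyz hjb hm
  have hVU : V = U := by
    refine S.encode_inj V U Q' hQ' fun j hj => ?_
    have hx := hsh j hj
    rw [← hV.root_eq] at hx
    exact eq_share_of_mem_validShares hx
  subst hVU
  exact ⟨h, hV.mono ht'.le, hcom⟩

/-! ### The units of honest nodes -/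

open Classical in
variable (E) in
/-- The unit of DAG-round `r` created by the honest node `i`; a junk value if there is none. -/
noncomputable def ownUnit (i : Fin (3 * f + 1)) (r : ℕ) : DagUnit (3 * f + 1) Data :=
  if h : ∃ U t k, (k, proposalMsg S r U k) ∈ E.log i t then h.choose
  else DagUnit.mk i [] (E.input i 0)

theorem proposalMsg_inj {U V : DagUnit (3 * f + 1) Data} {k k' : Fin (3 * f + 1)}
    (h : proposalMsg S r U k = proposalMsg S r' V k') : U = V := by
  rw [proposalMsg, proposalMsg, RbcMsg.propose.injEq] at h
  exact root_encode_injective S h.2.1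

theorem proposalMsg_unique (hi : i ∉ byz) {U V : DagUnit (3 * f + 1) Data}
    {k' : Fin (3 * f + 1)} (hU : (k, proposalMsg S r U k) ∈ E.log i t)
    (hV : (k', proposalMsg S r V k') ∈ E.log i t') : U = V := by
  obtain ⟨C, hC⟩ := (localInv hi (max t t')).own
  have h1 := (hC.propose_mem _ _ _ _ _ (log_mono (le_max_left t t') hU)).2
  have h2 := (hC.propose_mem _ _ _ _ _ (log_mono (le_max_right t t') hV)).2
  exact (proposalMsg_inj h1).trans (proposalMsg_inj h2).symm

theorem ownUnits (hi : i ∉ byz) (t : ℕ) :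
    OwnUnits S i (E.input i) (E.log i t) (E.state t i) (E.ownUnit i) := by
  obtain ⟨C, hC⟩ := (localInv hi t).own
  have heq : ∀ r < (E.state t i).next, C r = E.ownUnit i r := by
    intro r hr
    have h1 := hC.proposed r hr i
    have h2 : ∃ U t k, (k, proposalMsg S r U k) ∈ E.log i t := ⟨_, _, _, h1⟩
    rw [ownUnit, dif_pos h2]
    obtain ⟨t', k, hk⟩ := h2.choose_spec
    exact proposalMsg_unique hi h1 hk
  refine ⟨?_, ?_, ?_, ?_, ?_⟩
  · exact fun r hr => heq r hr ▸ hC.mem_dag r hr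
  · intro r hr
    obtain ⟨D, hD, hc⟩ := hC.created r hr
    exact ⟨D, hD, hc.congr fun r' hr' => heq r' (hr'.trans_lt hr)⟩
  · exact fun r hr => heq r hr ▸ hC.proposed r hr
  · intro k r h b σ hm
    obtain ⟨h1, h2⟩ := hC.propose_mem k r h b σ hm
    exact ⟨h1, heq r h1 ▸ h2⟩
  · intro U hU
    refine (hC.dag_cases U hU).imp_right ?_
    rintro ⟨r, hr, h⟩
    exact ⟨r, hr, heq r hr ▸ h⟩

theorem creator_ownUnit (hi : i ∉ byz) (hr : r < (E.state t i).next) :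
    (E.ownUnit i r).creator = i := by
  obtain ⟨D, -, hc⟩ := (ownUnits hi t).created r hr
  exact hc.creator

theorem round_ownUnit (hi : i ∉ byz) (hr : r < (E.state t i).next) :
    (E.ownUnit i r).round = r := by
  obtain ⟨D, -, hc⟩ := (ownUnits hi t).created r hr
  refine le_antisymm ((DagUnit.round_le_iff _ _).2 fun V hV => (hc.maximal V hV).2.1) ?_
  rcases Nat.eq_zero_or_pos r with rfl | hpos
  · exact Nat.zero_le _
  · obtain ⟨Q, hQ, hall⟩ := hc.wait hpos
    obtain ⟨W, hW⟩ := Finset.card_pos.1 (show 0 < Q.card by omega)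
    obtain ⟨h1, h2⟩ := hall W hW
    obtain ⟨V, hV, hVW⟩ := hc.complete W h1 (by omega)
    have h3 := (hc.maximal V hV).2.2 W h1 hVW.symm (by omega)
    have h4 := DagUnit.round_lt_of_mem_parents hV
    omega

/-- The units of an honest creator can only be certified if they were proposed by it. -/
theorem Certified.eq_ownUnit (hbyz : byz.card ≤ f) (hs : s ∉ byz) {h : Digest}
    {U : DagUnit (3 * f + 1) Data} (hc : E.Certified s r h U t) :
    r < (E.state t s).next ∧ U = E.ownUnit s r := by
  have hroot := hc.root_eq
  obtain ⟨i, hi, hp, -⟩ := hc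
  obtain ⟨Q, hQ, hj⟩ := exists_prevote_of_prevotesFrom hi hp
  obtain ⟨j, hjQ, hjb⟩ := exists_honest_of_card hbyz (Q := Q) (by omega)
  obtain ⟨b, σ, -, hm⟩ := hj j hjQ
  have h1 := ((localInv hjb t).prevoted_of_prevote _ _ _ _ _ _ hm).2
  obtain ⟨t', ht', hm'⟩ := mem_log_of_mem_rcvd hjb
    ((localInv hjb t).rcvd_of_proposal _ _ _ _ _ h1)
  obtain ⟨h2, h3⟩ := (ownUnits hs t).propose_mem _ _ _ _ _ (log_mono ht'.le hm')
  refine ⟨h2, root_encode_injective S ?_⟩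
  rw [proposalMsg, RbcMsg.propose.injEq] at h3
  exact hroot.trans h3.2.1

theorem dag_cases (hbyz : byz.card ≤ f) (hi : i ∉ byz) {U : DagUnit (3 * f + 1) Data}
    (hU : U ∈ (E.state t i).dag) :
    (∃ h, E.Certified U.creator U.round h U t) ∨
      ∃ r < (E.state t i).next, U = E.ownUnit i r := by
  refine ((ownUnits hi t).dag_cases U hU).imp_left ?_
  rintro ⟨s, r, ho⟩
  obtain ⟨h, hc, -⟩ := exists_certified_of_output hbyz hi ho
  obtain ⟨h1, h2, -⟩ := hc.validUnit
  exact ⟨h, by rw [h1, h2]; exact hc⟩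

theorem eq_ownUnit_of_mem_dag (hbyz : byz.card ≤ f) (hi : i ∉ byz) {U : DagUnit (3 * f + 1) Data}
    (hU : U ∈ (E.state t i).dag) (hcr : U.creator ∉ byz) :
    U.round < (E.state t U.creator).next ∧ U = E.ownUnit U.creator U.round := by
  rcases dag_cases hbyz hi hU with ⟨h, hc⟩ | ⟨r, hr, rfl⟩
  · exact hc.eq_ownUnit hbyz hcr
  · rw [creator_ownUnit hi hr, round_ownUnit hi hr]
    exact ⟨hr, rfl⟩

theorem forkFree (hbyz : byz.card ≤ f) : ForkFree byz E.localDag := by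
  intro i₁ hi₁ i₂ hi₂ t₁ t₂ U₁ hU₁ U₂ hU₂ hcr hrd
  by_cases hb : U₁.creator ∈ byz
  · have key : ∀ {i t U}, i ∉ byz → U ∈ E.localDag i t → U.creator ∈ byz →
        ∃ h, E.Certified U.creator U.round h U t := by
      intro i t U hi hU hb
      rcases dag_cases hbyz hi hU with h | ⟨r, hr, rfl⟩
      · exact h
      · rw [creator_ownUnit hi hr] at hb
        exact absurd hb hi
    obtain ⟨h₁, hc₁⟩ := key hi₁ hU₁ hb
    obtain ⟨h₂, hc₂⟩ := key hi₂ hU₂ (hcr ▸ hb)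
    rw [← hcr, ← hrd] at hc₂
    exact (hc₁.unique hbyz hc₂).2
  · rw [(eq_ownUnit_of_mem_dag hbyz hi₁ hU₁ hb).2,
      (eq_ownUnit_of_mem_dag hbyz hi₂ hU₂ (hcr ▸ hb)).2, hcr, hrd]

/-- The `2f+1` units awaited before the creation of a unit have distinct creators, so that they all
become parents. -/
theorem disseminated_ownUnit (hbyz : byz.card ≤ f) (hi : i ∉ byz)
    (hr : r < (E.state t i).next) : (E.ownUnit i r).Disseminated f := by
  intro hpos
  rw [round_ownUnit hi hr] at hpos ⊢
  obtain ⟨D, hD, hc⟩ := (ownUnits hi t).created r hr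
  obtain ⟨Q, hQ, hall⟩ := hc.wait hpos
  refine ⟨Q, hQ, fun W hW => ⟨?_, (hall W hW).2⟩⟩
  obtain ⟨h1, h2⟩ := hall W hW
  obtain ⟨V, hV, hVW⟩ := hc.complete W h1 (by omega)
  obtain ⟨h3, h4, h5⟩ := hc.maximal V hV
  have h6 := h5 W h1 hVW.symm (by omega)
  rwa [← forkFree hbyz i hi i hi t t V (hD h3) W (hD h1) hVW (by omega)]

theorem ownUnit_mem_parents (hbyz : byz.card ≤ f) (hi : i ∉ byz)
    (hr : r + 1 < (E.state t i).next) : E.ownUnit i r ∈ (E.ownUnit i (r + 1)).parents := by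
  obtain ⟨D, hD, hc⟩ := (ownUnits hi t).created (r + 1) hr
  have h1 := hc.earlier r (Nat.lt_succ_self r)
  have hrd := round_ownUnit hi (Nat.lt_of_succ_lt hr)
  obtain ⟨V, hV, hcr⟩ := hc.complete _ h1 (by omega)
  obtain ⟨h3, h4, h5⟩ := hc.maximal V hV
  have h6 := h5 _ h1 hcr.symm (by omega)
  rwa [← forkFree hbyz i hi i hi t t V (hD h3) _ (hD h1) hcr (by omega)]

theorem below_ownUnit (hbyz : byz.card ≤ f) (hi : i ∉ byz) (hrr : r ≤ r')
    (hr : r' < (E.state t i).next) : (E.ownUnit i r).Below (E.ownUnit i r') := by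
  induction hrr with
  | refl => exact Relation.ReflTransGen.refl
  | step _ ih => exact (ih (Nat.lt_of_succ_lt hr)).tail (ownUnit_mem_parents hbyz hi hr)

theorem isChDag (hbyz : byz.card ≤ f) (hi : i ∉ byz) (t : ℕ) :
    IsChDag f byz (E.localDag i t) where
  closed := (localInv hi t).closed
  chains := by
    intro j hj U hU V hV hUj hVj
    obtain ⟨h1, h2⟩ := eq_ownUnit_of_mem_dag hbyz hi hU (hUj ▸ hj)
    obtain ⟨h3, h4⟩ := eq_ownUnit_of_mem_dag hbyz hi hV (hVj ▸ hj)
    rw [hUj] at h1 h2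
    rw [hVj] at h3 h4
    rw [h2, h4]
    exact (le_total U.round V.round).imp (fun h => below_ownUnit hbyz hj h h3)
      fun h => below_ownUnit hbyz hj h h1
  dissemination := by
    intro U hU
    rcases dag_cases hbyz hi hU with ⟨h, hc⟩ | ⟨r, hr, rfl⟩
    · exact hc.validUnit.2.2.1
    · exact disseminated_ownUnit hbyz hi hr
  diversity := by
    intro U hU
    rcases dag_cases hbyz hi hU with ⟨h, hc⟩ | ⟨r, hr, rfl⟩
    · exact hc.validUnit.2.2.2.1
    · obtain ⟨D, -, hc⟩ := (ownUnits hi t).created r hr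
      exact hc.diverse

theorem validUnit_ownUnit (hbyz : byz.card ≤ f) (hvalid : E.HonestInputsValid) (hi : i ∉ byz)
    (hr : r < (E.state t i).next) : ValidUnit S i r (E.ownUnit i r) := by
  obtain ⟨D, -, hc⟩ := (ownUnits hi t).created r hr
  refine ⟨hc.creator, round_ownUnit hi hr, disseminated_ownUnit hbyz hi hr, hc.diverse, ?_, ?_⟩
  · intro hpos
    obtain ⟨r, rfl⟩ := Nat.exists_eq_succ_of_ne_zero hpos.ne'
    exact ⟨_, ownUnit_mem_parents hbyz hi hr, creator_ownUnit hi (Nat.lt_of_succ_lt hr)⟩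
  · rw [hc.data]
    exact hvalid i hi r

end Execution

/-! ### Asynchronous rounds -/

theorem List.exists_bound_of_forall_exists {α : Type*} (L : List α) {p : α → ℕ → Prop}
    (h : ∀ a ∈ L, ∃ t, p a t) : ∃ T, ∀ a ∈ L, ∃ t ≤ T, p a t := by
  induction L with
  | nil => exact ⟨0, by simp⟩
  | cons a L ih =>
    obtain ⟨T, hT⟩ := ih fun b hb => h b (List.mem_cons_of_mem a hb)
    obtain ⟨t, ht⟩ := h a List.mem_cons_self
    refine ⟨max T t, fun b hb => ?_⟩
    rcases List.mem_cons.1 hb with rfl | hb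
    · exact ⟨t, le_max_right _ _, ht⟩
    · obtain ⟨t', h1, h2⟩ := hT b hb
      exact ⟨t', h1.trans (le_max_left _ _), h2⟩

namespace Execution

variable {f : ℕ} {Data : Type u} {Share : Type v} {Digest : Type w}
  {S : Params f Data Share Digest} {byz : Finset (Fin (3 * f + 1))} {E : Execution S byz}
  {i j k s : Fin (3 * f + 1)} {t t' r r' n : ℕ} {l : ℕ → ℕ}

theorem exists_isRoundEnds (E : Execution S byz) : ∃ l, E.IsRoundEnds l := by
  obtain ⟨l₀, hl₀⟩ : ∃ l₀, IsLeast {t | ∀ i, ∃ t' ≤ t, E.actor t' = i} l₀ := by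
    obtain ⟨T, hT⟩ := (List.finRange (3 * f + 1)).exists_bound_of_forall_exists
      (p := fun i t => E.actor t = i) fun i _ => E.all_act i
    have hne : {t | ∀ i, ∃ t' ≤ t, E.actor t' = i}.Nonempty :=
      ⟨T, fun i => hT i (List.mem_finRange i)⟩
    exact ⟨_, Nat.sInf_mem hne, fun _ h => Nat.sInf_le h⟩
  have hstep : ∀ a b, ∃ c, IsLeast {t | b < t ∧ ∀ τ, a ≤ τ ∧ τ ≤ b → ∀ m ∈ E.sent τ,
      ∃ t' ≤ t, Packet.mk τ m.1 m.2 ∈ E.delivered t'} c := by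
    intro a b
    obtain ⟨T, hT⟩ := (List.range (b + 1)).exists_bound_of_forall_exists
      (p := fun τ t => ∀ m ∈ E.sent τ, ∃ t' ≤ t, Packet.mk τ m.1 m.2 ∈ E.delivered t')
      fun τ _ => (E.sent τ).exists_bound_of_forall_exists fun m hm => E.eventually_delivered τ m hm
    have hne : {t | b < t ∧ ∀ τ, a ≤ τ ∧ τ ≤ b → ∀ m ∈ E.sent τ,
        ∃ t' ≤ t, Packet.mk τ m.1 m.2 ∈ E.delivered t'}.Nonempty := by
      refine ⟨max T (b + 1), by simp, fun τ hτ m hm => ?_⟩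
      obtain ⟨t, h1, h2⟩ := hT τ (List.mem_range.2 (Nat.lt_succ_of_le hτ.2))
      obtain ⟨t', h3, h4⟩ := h2 m hm
      exact ⟨t', (h3.trans h1).trans (le_max_left _ _), h4⟩
    exact ⟨_, Nat.sInf_mem hne, fun _ h => Nat.sInf_le h⟩
  choose g hg using hstep
  -- The pairs of the first and the last step of each round.
  let p : ℕ → ℕ × ℕ := fun n => Nat.rec (0, l₀) (fun _ q => (q.2 + 1, g q.1 q.2)) n
  have hmono : StrictMono fun n => (p n).2 :=
    strictMono_nat_of_lt_succ fun n => (hg (p n).1 (p n).2).1.1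
  refine ⟨fun n => (p n).2, hl₀, fun r => ?_⟩
  have hround : ∀ τ, InRound (fun n => (p n).2) r τ ↔ (p r).1 ≤ τ ∧ τ ≤ (p r).2 := by
    intro τ
    refine and_comm.trans (and_congr_left' ?_)
    cases r with
    | zero => exact ⟨fun _ => Nat.zero_le τ, fun _ k hk => by omega⟩
    | succ r =>
      exact ⟨fun h => h r (Nat.lt_succ_self r),
        fun h k hk => (hmono.monotone (Nat.lt_succ_iff.1 hk)).trans_lt h⟩
  simp only [hround]
  exact hg (p r).1 (p r).2

theorem IsRoundEnds.strictMono (hl : E.IsRoundEnds l) : StrictMono l :=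
  strictMono_nat_of_lt_succ fun n => (hl.2 n).1.1

theorem IsRoundEnds.succ_le_succ (hl : E.IsRoundEnds l) {m n : ℕ} (h : m ≤ n) :
    l m + 1 ≤ l n + 1 :=
  Nat.succ_le_succ (hl.strictMono.monotone h)

/-- What is sent by the end of an asynchronous round is received by the end of the next one. -/
theorem IsRoundEnds.mem_rcvd_of_mem_log (hl : E.IsRoundEnds l) (hj : j ∉ byz)
    {m : RbcMsg (3 * f + 1) Share Digest} (hm : (j, m) ∈ E.log i (l n + 1)) :
    (i, m) ∈ (E.state (l (n + 1) + 1) j).rcvd := by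
  classical
  obtain ⟨τ, hτ, rfl, hsent⟩ := hm
  have hex : ∃ q, τ ≤ l q := ⟨n, Nat.lt_succ_iff.1 hτ⟩
  have hin : InRound l (Nat.find hex) τ :=
    ⟨Nat.find_spec hex, fun k hk => not_le.1 (Nat.find_min hex hk)⟩
  obtain ⟨t', ht', hd⟩ := (hl.2 (Nat.find hex)).1.2 τ hin _ hsent
  have hle : Nat.find hex ≤ n := Nat.find_min' hex (Nat.lt_succ_iff.1 hτ)
  have hll := hl.strictMono.monotone (Nat.succ_le_succ hle)
  exact mem_rcvd_of_delivered (p := ⟨τ, j, m⟩) hj hd (Nat.lt_succ_of_le (ht'.trans hll))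

theorem IsRoundEnds.not_act (hl : E.IsRoundEnds l) (hi : i ∉ byz) (n : ℕ) :
    ∀ st, ¬ Act S i (E.input i) (E.state (l n + 1) i) st := by
  obtain ⟨t₀, ht₀, hact⟩ := hl.1.1 i
  have hn := hl.strictMono.monotone (Nat.zero_le n)
  exact Execution.not_act hi hact (by omega)

/-! ### Totality of local outputs -/

/-- If every honest node has committed in an instance with a certified unit, then all of them
output this unit within one asynchronous round: their commits are for the certified root, and the
`f+1` honest prevotes behind the certificate have reached everyone. -/
theorem IsRoundEnds.output_of_committed (hl : E.IsRoundEnds l) (hbyz : byz.card ≤ f)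
    {h : Digest} {U : DagUnit (3 * f + 1) Data} (hc : E.Certified s r h U (l n + 1))
    (hcom : ∀ j, j ∉ byz → (s, r) ∈ (E.state (l n + 1) j).committed) (hk : k ∉ byz) :
    (E.state (l (n + 1) + 1) k).output s r = some U := by
  have hcommits : (E.state (l (n + 1) + 1) k).CommitsFrom (2 * f + 1) s r h := by
    refine ⟨byzᶜ, card_honest hbyz, fun j hj => ?_⟩
    have hj := Finset.mem_compl.1 hj
    obtain ⟨h', hm⟩ := (localInv hj _).commit_of_committed s r (hcom j hj)
    obtain ⟨U', hc'⟩ := exists_certified_of_commit hbyz hj (hm k)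
    rw [(hc.unique hbyz hc').1]
    exact hl.mem_rcvd_of_mem_log hk (hm k)
  have hroot := hc.root_eq
  have hdec : Decodes S ((E.state (l (n + 1) + 1) k).validShares S.hash s r h) U := by
    obtain ⟨i, hi, hp, -⟩ := hc
    obtain ⟨Q, hQ, hall⟩ := exists_prevote_of_prevotesFrom hi hp
    refine ⟨⟨Q \ byz, card_honest_of_card hbyz hQ, fun j hj => ?_⟩, fun x hx => ?_⟩
    · obtain ⟨hjQ, hjb⟩ := Finset.mem_sdiff.1 hj
      obtain ⟨b, σ, hv, hm⟩ := hall j hjQ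
      exact ⟨σ, b, hl.mem_rcvd_of_mem_log hk (multicast_of_prevote hjb hm k), hv⟩
    · rw [← hroot] at hx
      exact eq_share_of_mem_validShares hx
  cases ho : (E.state (l (n + 1) + 1) k).output s r with
  | none => exact absurd (Act.output _ s r h U hcommits hdec ho) (hl.not_act hk _ _)
  | some V =>
    obtain ⟨h', hc', -⟩ := exists_certified_of_output hbyz hk ho
    rw [(hc.unique hbyz hc').2]

/-- Totality: an output of one honest node is output by all of them within two asynchronous
rounds, one for the `f+1` honest commits behind it and one for the commits that these provoke. -/
theorem IsRoundEnds.output_of_output (hl : E.IsRoundEnds l) (hbyz : byz.card ≤ f) (hi : i ∉ byz)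
    {U : DagUnit (3 * f + 1) Data} (ho : (E.state (l n + 1) i).output s r = some U)
    (hk : k ∉ byz) : (E.state (l (n + 2) + 1) k).output s r = some U := by
  obtain ⟨h, hc, Q, hQ, hall⟩ := exists_certified_of_output hbyz hi ho
  refine hl.output_of_committed hbyz (hc.mono (hl.succ_le_succ (Nat.le_succ n))) ?_ hk
  intro j hj
  by_contra hnew
  refine hl.not_act hj _ _ (Act.amplify _ s r h ?_ hnew)
  refine ⟨Q \ byz, card_honest_of_card hbyz hQ, fun q hq => ?_⟩
  obtain ⟨hqQ, hqb⟩ := Finset.mem_sdiff.1 hq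
  obtain ⟨t', ht', hm⟩ := mem_log_of_mem_rcvd hi (hall q hqQ)
  have hm' := ((localInv hqb _).ready_of_commit _ _ _ _ (log_mono ht'.le hm)).1 j
  exact hl.mem_rcvd_of_mem_log hj hm'

theorem IsRoundEnds.mem_dag_of_parents (hl : E.IsRoundEnds l) (hk : k ∉ byz)
    {U : DagUnit (3 * f + 1) Data} (ho : (E.state (l n + 1) k).HasOutput U)
    (hp : ∀ V ∈ U.parents, V ∈ (E.state (l n + 1) k).dag) : U ∈ (E.state (l n + 1) k).dag := by
  by_contra hnew
  exact hl.not_act hk _ _ (Act.attach _ U ho hp hnew)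

/-- An output of one honest node is in all honest local copies two asynchronous rounds later: the
parents of the unit were output by the node certifying it, and so the same holds for them. -/
theorem IsRoundEnds.mem_dag_of_hasOutput (hl : E.IsRoundEnds l) (hbyz : byz.card ≤ f)
    (hi : i ∉ byz) {U : DagUnit (3 * f + 1) Data} (ho : (E.state (l n + 1) i).HasOutput U)
    (hk : k ∉ byz) : U ∈ (E.state (l (n + 2) + 1) k).dag := by
  induction hd : U.round using Nat.strong_induction_on generalizing U i with
  | _ d ih =>
    obtain ⟨s, r, ho⟩ := ho
    refine hl.mem_dag_of_parents hk ⟨s, r, hl.output_of_output hbyz hi ho hk⟩ fun V hV => ?_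
    obtain ⟨h, ⟨i', hi', -, -, -, hpar⟩, -⟩ := exists_certified_of_output hbyz hi ho
    exact ih V.round (hd ▸ DagUnit.round_lt_of_mem_parents hV) hi' (hpar V hV) rfl

/-! ### Progress -/

/-- Three asynchronous rounds after all honest nodes have created their units of DAG-round `r`,
these units are output and in the local copies everywhere: the proposals, the prevotes and the
commits take one round each, and the parents of the units arrive meanwhile. -/
theorem IsRoundEnds.ownUnit_delivered (hl : E.IsRoundEnds l) (hbyz : byz.card ≤ f)
    (hvalid : E.HonestInputsValid) (hunif : E.UniformBuffers)
    (hnext : ∀ j, j ∉ byz → r < (E.state (l n + 1) j).next)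
    (hprev : ∀ r' < r, ∀ i, i ∉ byz → ∀ k, k ∉ byz →
      (E.state (l n + 1) k).HasOutput (E.ownUnit i r') ∧
        E.ownUnit i r' ∈ (E.state (l n + 1) k).dag)
    (hi : i ∉ byz) (hk : k ∉ byz) :
    (E.state (l (n + 3) + 1) k).HasOutput (E.ownUnit i r) ∧
      E.ownUnit i r ∈ (E.state (l (n + 3) + 1) k).dag := by
  have le₁ := hl.succ_le_succ (Nat.le_add_right n 1)
  have le₂ := hl.succ_le_succ (Nat.le_add_right n 2)
  have le₃ := hl.succ_le_succ (Nat.le_succ (n + 2))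
  have hown := ownUnits (E := E) hi (l n + 1)
  have hparents : ∀ V ∈ (E.ownUnit i r).parents, ∀ k, k ∉ byz →
      (E.state (l (n + 2) + 1) k).HasOutput V ∧ V ∈ (E.state (l (n + 2) + 1) k).dag := by
    intro V hV k hk
    have hVdag := (localInv hi _).closed _ (hown.mem_dag r (hnext i hi)) V hV
    rcases hown.dag_cases V hVdag with ho | ⟨r', hr', rfl⟩
    · refine ⟨?_, hl.mem_dag_of_hasOutput hbyz hi ho hk⟩
      obtain ⟨s, q, ho⟩ := ho
      exact ⟨s, q, hl.output_of_output hbyz hi ho hk⟩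
    · have hlt := DagUnit.round_lt_of_mem_parents hV
      rw [round_ownUnit hi hr', round_ownUnit hi (hnext i hi)] at hlt
      obtain ⟨h1, h2⟩ := hprev r' hlt i hi k hk
      exact ⟨h1.mono (state_le hk le₂), (state_le hk le₂).dag h2⟩
  have hprevote : ∀ j, j ∉ byz → ∀ k, (k, RbcMsg.prevote i r
      (Merkle.root S.hash (S.encode (E.ownUnit i r)))
      (Merkle.branch S.hash (S.encode (E.ownUnit i r)) j) (S.encode (E.ownUnit i r) j)) ∈
      E.log j (l (n + 1) + 1) := by
    intro j hj
    have hinv := localInv (E := E) hj (l (n + 1) + 1)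
    have hrcvd := hl.mem_rcvd_of_mem_log hj (hown.proposed r (hnext i hi) j)
    obtain ⟨⟨h, b, σ⟩, hprop⟩ := hinv.proposal_of_rcvd _ _ _ _ _ hrcvd
    obtain ⟨t', -, hm⟩ := mem_log_of_mem_rcvd hj (hinv.rcvd_of_proposal _ _ _ _ _ hprop)
    have heq := ((ownUnits hi t').propose_mem _ _ _ _ _ hm).2
    rw [proposalMsg, RbcMsg.propose.injEq] at heq
    obtain ⟨-, rfl, rfl, rfl⟩ := heq
    have hprevoted : (i, r) ∈ (E.state (l (n + 1) + 1) j).prevoted := by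
      by_contra hnew
      refine hl.not_act hj _ _ (Act.prevote _ i r _ _ _ hprop ?_ (fun _ => ?_) hnew)
      · obtain ⟨D, -, hc⟩ := hown.created r (hnext i hi)
        rw [S.shareTx_encode, hc.data]
        exact hunif i hi j hj r
      · exact ⟨_, (state_le hj le₁).dag ((ownUnits hj _).mem_dag r (hnext j hj)),
          (round_ownUnit hj (hnext j hj)).ge.trans (Nat.le_succ _)⟩
    obtain ⟨h, b, σ, hlog⟩ := hinv.prevote_of_prevoted _ _ hprevoted
    have hsame := (hinv.prevoted_of_prevote _ _ _ _ _ _ (hlog j)).2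
    rw [hprop] at hsame
    cases hsame
    exact hlog
  have hvotes : ∀ k, k ∉ byz → (E.state (l (n + 2) + 1) k).PrevotesFrom S.hash (2 * f + 1) i r
      (Merkle.root S.hash (S.encode (E.ownUnit i r))) := fun k hk =>
    ⟨byzᶜ, card_honest hbyz, fun j hj => ⟨_, _,
      hl.mem_rcvd_of_mem_log hk (hprevote j (Finset.mem_compl.1 hj) k),
      Merkle.verifies_branch _ j⟩⟩
  have hval := validUnit_ownUnit hbyz hvalid hi (hnext i hi)
  have hcom : ∀ k, k ∉ byz → (i, r) ∈ (E.state (l (n + 2) + 1) k).committed := by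
    intro k hk
    by_contra hnew
    obtain ⟨Q, hQ, hall⟩ := hvotes k hk
    exact hl.not_act hk _ _ (Act.commit _ i r _ _ (hvotes k hk)
      ⟨⟨Q, by omega, hall⟩, fun x hx => eq_share_of_mem_validShares hx⟩ hval
      (fun V hV => (hparents V hV k hk).1) rfl hnew)
  have hcert : E.Certified i r (Merkle.root S.hash (S.encode (E.ownUnit i r))) (E.ownUnit i r)
      (l (n + 2) + 1) :=
    ⟨k, hk, hvotes k hk, hval, rfl, fun V hV => (hparents V hV k hk).1⟩
  have hout : (E.state (l (n + 3) + 1) k).HasOutput (E.ownUnit i r) :=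
    ⟨i, r, hl.output_of_committed hbyz hcert hcom hk⟩
  exact ⟨hout, hl.mem_dag_of_parents hk hout fun V hV =>
    (state_le hk le₃).dag (hparents V hV k hk).2⟩

theorem IsRoundEnds.next_pos (hl : E.IsRoundEnds l) (hi : i ∉ byz) (n : ℕ) :
    0 < (E.state (l n + 1) i).next := by
  by_contra h
  obtain ⟨P, hP⟩ := (E.state (l n + 1) i).exists_isParentChoice (E.state (l n + 1) i).next
  exact hl.not_act hi n _ (Act.create _ P _ (fun h' => absurd h' h) hP rfl)

theorem IsRoundEnds.succ_lt_next (hl : E.IsRoundEnds l) (hbyz : byz.card ≤ f) (hi : i ∉ byz)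
    (hr : r < (E.state (l n + 1) i).next) (hnext : ∀ j, j ∉ byz → r < (E.state t j).next)
    (hdag : ∀ j, j ∉ byz → E.ownUnit j r ∈ (E.state (l n + 1) i).dag) :
    r + 1 < (E.state (l n + 1) i).next := by
  classical
  by_contra h
  have hnx : (E.state (l n + 1) i).next = r + 1 := by omega
  obtain ⟨P, hP⟩ := (E.state (l n + 1) i).exists_isParentChoice (E.state (l n + 1) i).next
  refine hl.not_act hi n _ (Act.create _ P _ (fun _ => ?_) hP rfl)
  refine ⟨byzᶜ.image fun j => E.ownUnit j r, ?_, fun V hV => ?_⟩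
  · rw [Finset.card_image_of_injOn]
    · exact card_honest hbyz
    · intro j hj j' hj' heq
      have hj := Finset.mem_compl.1 hj
      have hj' := Finset.mem_compl.1 hj'
      rw [← creator_ownUnit hj (hnext j hj), ← creator_ownUnit hj' (hnext j' hj')]
      exact congrArg DagUnit.creator heq
  · obtain ⟨j, hj, rfl⟩ := Finset.mem_image.1 hV
    have hj := Finset.mem_compl.1 hj
    exact ⟨hdag j hj, by rw [round_ownUnit hj (hnext j hj), hnx]⟩

/-- Every DAG-round takes at most three asynchronous rounds. -/
theorem IsRoundEnds.progress (hl : E.IsRoundEnds l) (hbyz : byz.card ≤ f)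
    (hvalid : E.HonestInputsValid) (hunif : E.UniformBuffers) (r : ℕ) :
    (∀ i, i ∉ byz → r < (E.state (l (3 * r) + 1) i).next) ∧
      ∀ i, i ∉ byz → ∀ k, k ∉ byz →
        (E.state (l (3 * r + 3) + 1) k).HasOutput (E.ownUnit i r) ∧
          E.ownUnit i r ∈ (E.state (l (3 * r + 3) + 1) k).dag := by
  induction r using Nat.strong_induction_on with
  | _ r ih =>
    have hnext : ∀ i, i ∉ byz → r < (E.state (l (3 * r) + 1) i).next := by
      intro i hi
      rcases r with _ | r
      · exact hl.next_pos hi 0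
      · obtain ⟨h1, h2⟩ := ih r (Nat.lt_succ_self r)
        exact hl.succ_lt_next hbyz hi
          ((h1 i hi).trans_le (state_le hi (hl.succ_le_succ (by omega))).next) h1
          fun j hj => (h2 j hj i hi).2
    refine ⟨hnext, fun i hi k hk => hl.ownUnit_delivered hbyz hvalid hunif hnext ?_ hi hk⟩
    intro r' hr' i hi k hk
    obtain ⟨h1, h2⟩ := (ih r' hr').2 i hi k hk
    have hle := state_le (E := E) hk (hl.succ_le_succ (show 3 * r' + 3 ≤ 3 * r by omega))
    exact ⟨h1.mono hle, hle.dag h2⟩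

theorem IsRoundEnds.exists_ownUnit (hl : E.IsRoundEnds l) (hbyz : byz.card ≤ f)
    (hvalid : E.HonestInputsValid) (hunif : E.UniformBuffers) (hi : i ∉ byz)
    (h : l (3 * r) < t) : ∃ U ∈ E.localDag i t, U.creator = i ∧ U.round = r := by
  have hr := (hl.progress hbyz hvalid hunif r).1 i hi
  exact ⟨E.ownUnit i r, (state_le hi (Nat.succ_le_of_lt h)).dag ((ownUnits hi _).mem_dag r hr),
    creator_ownUnit hi hr, round_ownUnit hi hr⟩

theorem IsRoundEnds.reliable (hl : E.IsRoundEnds l) (hbyz : byz.card ≤ f)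
    (hvalid : E.HonestInputsValid) (hunif : E.UniformBuffers) : Reliable byz E.localDag := by
  intro i hi t U hU j hj
  rcases (ownUnits hi t).dag_cases U hU with ho | ⟨r, -, rfl⟩
  · have ht : t ≤ l t + 1 := (hl.strictMono.le_apply).trans (Nat.le_succ _)
    exact ⟨_, hl.mem_dag_of_hasOutput hbyz hi (ho.mono (state_le hi ht)) hj⟩
  · exact ⟨_, ((hl.progress hbyz hvalid hunif r).2 i hi j hj).2⟩

end Execution

theorem theorem3p2 {Data : Type u} {Share : Type v} {Digest : Type w} (f : ℕ) (hf : 1 ≤ f)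
    (S : Params f Data Share Digest) (byz : Finset (Fin (3 * f + 1))) (hbyz : byz.card ≤ f)
    (E : Execution S byz) (hvalid : E.HonestInputsValid) (hunif : E.UniformBuffers) :
    (∀ i, i ∉ byz → ∀ t, IsChDag f byz (E.localDag i t)) ∧
    Reliable byz E.localDag ∧
    EverExpanding byz E.localDag ∧
    ForkFree byz E.localDag ∧
    (∃ l, E.IsRoundEnds l) ∧
    ∀ l, E.IsRoundEnds l → ∀ r, 1 ≤ r → ∀ t, Execution.InRound l r t → ∀ i, i ∉ byz →
      ∃ U ∈ E.localDag i t, U.creator = i ∧ r / 5 ≤ U.round := by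
  obtain ⟨l, hl⟩ := E.exists_isRoundEnds
  refine ⟨fun i hi t => Execution.isChDag hbyz hi t, hl.reliable hbyz hvalid hunif, ?_,
    Execution.forkFree hbyz, ⟨l, hl⟩, ?_⟩
  · intro i hi n
    obtain ⟨U, hU, -, hr⟩ := hl.exists_ownUnit hbyz hvalid hunif hi (Nat.lt_succ_self (l (3 * n)))
    exact ⟨_, U, hU, hr.ge⟩
  · intro l hl r hr t ht i hi
    -- Round `r` starts after round `r - 1`, and `3 * (r / 5) ≤ r - 1` as `1 ≤ r`.
    obtain ⟨U, hU, hcr, hrd⟩ := hl.exists_ownUnit hbyz hvalid hunif hi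
      (ht.2 (3 * (r / 5)) (by omega))
    exact ⟨U, hU, hcr, hrd.ge⟩
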